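/- **Setting.** Let $\sigma_{\mathrm{ar}}$ be the signature with $0$, $S$, $<$ (a relation symbol) and a function symbol for every (definition of a) primitive recursive function, and let $\mathcal N$ be the standard $\sigma_{\mathrm{ar}}$-structure on $\mathbb N$. Let $\sigma\supseteq\sigma_{\mathrm{ar}}$ be any signature. Formulas are built with $\neg,\lor,\forall$, and $\varphi\to\psi$, $\varphi\land\psi$, $\exists x\varphi$ abbreviate $\neg\varphi\lor\psi$, $\neg(\neg\varphi\lor\neg\psi)$, $\neg\forall x\neg\varphi$; $t\le s$ is $t<s\lor t=s$, and the bounded quantification $\forall x\le t\,\varphi$ is $\forall x(\neg\, x\le t\lor\varphi)$, where $x$ does not occur in $t$. A formula is quantifier-free if all its quantifiers are bounded, and universal if it is a quantifier-free formula prefixed with universal quantifiers. $\mathsf{PA}^\sigma$ is first-order Peano arithmetic with the defining equations of the primitive recursive function symbols and with induction for all $\sigma$-formulas. Let $\Gamma$ be a set of universal $\sigma$-sentences. Provability is in classical first-order logic with equality. **$\omega$-terms.** Finite types are generated from $0$ by $\to$; put $(\rho_1,\dots,\rho_n)\to\tau:=\rho_1\to(\dots\to(\rho_n\to\tau))$ and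 $\vec\rho\to(\tau_1,\dots,\tau_m):=(\vec\rho\to\tau_1,\dots,\vec\rho\to\tau_m)$. The $\omega$-terms are the simply typed $\lambda$-terms (with countably many variables of each type, those of type $0$ being the first-order variables) over constants $f:0^n\to 0$ for $0$, $S$ and the $n$-ary function symbols $f$ of $\sigma$ not in $\sigma_{\mathrm{ar}}$ and case distinction constants $c_\varphi:0^{m+2}\to 0$ for the quantifier-free $\sigma$-formulas $\varphi$ that have exactly $m$ free variables and contain a symbol not in $\sigma_{\mathrm{ar}}$, with one additional formation rule: if $t_n$ ($n\in\mathbb N$) are terms of type $\rho$, then $(t_n)_{n\in\mathbb N}$ is a term of type $0\to\rho$. The first-order terms are embedded by $\iota$, the other primitive recursive function symbols being translated by means of $\lambda$ and the infinite recursor terms $R_{a,b}=(t_n)_n$, $t_0=a$, $t_{n+1}=b\,\underline n\,t_n$, where $\underline n$ is the $n$-th numeral. The $\omega$-formulas are built from $\omega$-terms with the relation symbols of $\sigma$, equality of type $0$, $\neg$, $\lor$, and $\forall$ over all types; $\iota$ extends to formulas. For a $\sigma$-structure $\mathcal M$ whose $\sigma_{\mathrm{ar}}$-reduct is $\mathcal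 N$, and a higher-type valuation $e$ (an element of $\mathbb N_\rho$ for each variable of type $\rho$, where $\mathbb N_0=\mathbb N$, $\mathbb N_{\rho\to\tau}=\mathbb N_\tau^{\mathbb N_\rho}$), $\omega$-terms and $\omega$-formulas are evaluated in the full set-theoretic type structure over $\mathbb N$: function and relation symbols are interpreted as in $\mathcal M$, $(t_n)_n$ denotes $m\mapsto$ the value of $t_m$, and $c_\varphi a_1\dots a_m b_1b_2$ is $b_1$ if $\varphi$ is true in $\mathcal M$ at $a_1,\dots,a_m$ (the values of its free variables in order of appearance), and $b_2$ otherwise. **Interpretation.** To each $\sigma$-formula $\varphi$ one associates, up to renaming of variables, an $\omega$-formula $\varphi_{\mathrm{Sh}}$ and disjoint tuples of typed variables $\underline u_\varphi,\underline x_\varphi$: * $\varphi$ atomic: $\varphi_{\mathrm{Sh}}=\iota(\varphi)$, both tuples empty; * $\varphi=\neg\psi$: $\underline u_\varphi=\underline f$ with $\underline f$ fresh of type-tuple $\mathrm{tp}(\underline u_\psi)\to\mathrm{tp}(\underline x_\psi)$, $\underline x_\varphi=\underline u_\psi$, $\varphi_{\mathrm{Sh}}=\neg\psi_{\mathrm{Sh}}[\underline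 x_\psi:=\underline f\,\underline u_\psi]$; * $\varphi=\psi\lor\chi$: $\varphi_{\mathrm{Sh}}=\psi_{\mathrm{Sh}}\lor\chi_{\mathrm{Sh}}$, and the tuples are concatenated; * $\varphi=\forall z\le t\,\psi$ and $\underline x_\psi$ is empty: $\varphi_{\mathrm{Sh}}=\forall z\le t\,\psi_{\mathrm{Sh}}$, with the tuples of $\psi$; * $\varphi=\forall z\,\psi$ in all other cases: $\varphi_{\mathrm{Sh}}=\psi_{\mathrm{Sh}}$, $\underline u_\varphi=(z),\underline u_\psi$, $\underline x_\varphi=\underline x_\psi$. **Theorem (Soundness).** Let $\varphi$ be a $\sigma$-formula with $\mathsf{PA}^\sigma+\Gamma\vdash\varphi$. Then there is a tuple $\underline t$ of $\omega$-terms with $\mathrm{tp}(\underline t)=\mathrm{tp}(\underline u_\varphi)\to\mathrm{tp}(\underline x_\varphi)$ and $FV(\underline t)\subseteq FV(\varphi)$ such that for every $\sigma$-structure $\mathcal M$ whose $\sigma_{\mathrm{ar}}$-reduct is $\mathcal N$ and which satisfies $\Gamma$, and for every higher-type valuation $e$, the $\omega$-formula $$\forall \underline u_\varphi\,\bigl(\varphi_{\mathrm{Sh}}[\underline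 x_\varphi:=\underline t\,\underline u_\varphi]\bigr)$$ is true in $\mathcal M$ under $e$. -/

import Mathlib

universe u v

namespace ShInt

/-! ### The signature of arithmetic and its extensions -/

/-- Definitions of primitive recursive functions, by arity: zero, successor, projections,
composition and primitive recursion (on the first argument). -/
inductive PR : ℕ → Type
  | zero : PR 0
  | succ : PR 1
  | proj {n : ℕ} (i : Fin n) : PR n
  | comp {n k : ℕ} (g : PR k) (h : Fin k → PR n) : PR n
  | prec {n : ℕ} (g : PR n) (h : PR (n + 2)) : PR (n + 1)

/-- The primitive recursive function given by a definition. -/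
def PR.eval : {n : ℕ} → PR n → (Fin n → ℕ) → ℕ
  | _, .zero, _ => 0
  | _, .succ, a => a 0 + 1
  | _, .proj i, a => a i
  | _, .comp g h, a => g.eval (fun j => (h j).eval a)
  | _, .prec g h, a =>
      Nat.rec (g.eval (Fin.tail a))
        (fun y r => h.eval (Fin.cons y (Fin.cons r (Fin.tail a)))) (a 0)

/-- The only relation symbol of arithmetic other than equality: the binary symbol `<`. -/
inductive ArRel : ℕ → Type
  | lt : ArRel 2

/-- The signature of arithmetic: `0`, `S`, `<` and a symbol for every definition of a primitive
recursive function (the symbols `0` and `S` being `PR.zero` and `PR.succ`). -/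
def arith : FirstOrder.Language.{0, 0} := ⟨PR, ArRel⟩

/-- The interpretation of `<` over `ℕ`. -/
def ArRel.Holds : {n : ℕ} → ArRel n → (Fin n → ℕ) → Prop
  | _, .lt, a => a 0 < a 1

/-- The standard structure of arithmetic, with universe `ℕ`. -/
abbrev stdN : arith.Structure ℕ where
  funMap := fun {_} (f : PR _) a => f.eval a
  RelMap := fun {_} (R : ArRel _) a => R.Holds a

/-- A signature containing the signature of arithmetic; `L` consists of the further symbols. -/
def sig (L : FirstOrder.Language.{u, v}) : FirstOrder.Language.{u, v} := arith.sum L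

variable {L : FirstOrder.Language.{u, v}}

/-! ### First-order terms and formulas, with named variables -/

/-- First-order terms; the first-order variables are the natural numbers. -/
abbrev FTerm (L : FirstOrder.Language.{u, v}) := (sig L).Term ℕ

/-- The variables of a term, listed in order of appearance, with repetitions. -/
def tvars : FTerm L → List ℕ
  | .var x => [x]
  | .func _ ts => (List.ofFn fun i => tvars (ts i)).flatten

/-- Replacement of the variable `x` by the term `t` in a term. -/
def tsubst (x : ℕ) (t : FTerm L) (s : FTerm L) : FTerm L :=
  s.subst fun y => if y = x then t else .var y

/-- The function symbols of arithmetic applied to terms. -/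
def prT {n : ℕ} (f : PR n) (ts : Fin n → FTerm L) : FTerm L :=
  .func (Sum.inl f : (sig L).Functions n) ts

def zeroT : FTerm L := prT .zero ![]

def succT (t : FTerm L) : FTerm L := prT .succ ![t]

/-- First-order formulas, with basic operators `¬`, `∨`, `∀`. -/
inductive Fml (L : FirstOrder.Language.{u, v}) : Type (max u v)
  | eq (t s : FTerm L) : Fml L
  | rel {k : ℕ} (R : (sig L).Relations k) (ts : Fin k → FTerm L) : Fml L
  | neg (φ : Fml L) : Fml L
  | or (φ ψ : Fml L) : Fml L
  | all (x : ℕ) (φ : Fml L) : Fml L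

namespace Fml

def imp (φ ψ : Fml L) : Fml L := or (neg φ) ψ

def and (φ ψ : Fml L) : Fml L := neg (or (neg φ) (neg ψ))

def iff (φ ψ : Fml L) : Fml L := and (imp φ ψ) (imp ψ φ)

def lt (t s : FTerm L) : Fml L := rel (Sum.inl ArRel.lt : (sig L).Relations 2) ![t, s]

/-- `t ≤ s`, that is, `t < s ∨ t = s`. -/
def le (t s : FTerm L) : Fml L := or (lt t s) (eq t s)

/-- The free occurrences of variables, listed in order of appearance, with repetitions. -/
def fvl : Fml L → List ℕ
  | eq t s => tvars t ++ tvars s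
  | rel _ ts => (List.ofFn fun i => tvars (ts i)).flatten
  | neg φ => fvl φ
  | or φ ψ => fvl φ ++ fvl ψ
  | all x φ => (fvl φ).filter (fun y => decide (y ≠ x))

/-- The free variables `x₁, …, xₘ`, in order of (first) appearance, without repetitions. -/
def fvs (φ : Fml L) : List ℕ := φ.fvl.eraseDups

/-- The set of free variables. -/
def FV (φ : Fml L) : Set ℕ := {x | x ∈ φ.fvl}

def IsSentence (φ : Fml L) : Prop := φ.FV = ∅

/-- Replacement of the free occurrences of `x` by `t`. -/
def subst (x : ℕ) (t : FTerm L) : Fml L → Fml L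
  | eq s r => eq (tsubst x t s) (tsubst x t r)
  | rel R ts => rel R (fun i => tsubst x t (ts i))
  | neg φ => neg (subst x t φ)
  | or φ ψ => or (subst x t φ) (subst x t ψ)
  | all y φ => if y = x then all y φ else all y (subst x t φ)

/-- `x` is free for `t` in the formula: no free occurrence of `x` lies in the scope of a
quantifier `∀ y` where `y` is a variable of `t`. -/
def FreeFor (x : ℕ) (t : FTerm L) : Fml L → Prop
  | eq _ _ => True
  | rel _ _ => True
  | neg φ => FreeFor x t φ
  | or φ ψ => FreeFor x t φ ∧ FreeFor x t ψ
  | all y φ => x ∉ (all y φ).FV ∨ (y ∉ tvars t ∧ FreeFor x t φ)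

/-- `∀ x φ` is a bounded quantification `∀ x ≤ t ψ`, that is, `φ` is `¬ x ≤ t ∨ ψ`
for a term `t` in which `x` does not occur. -/
def IsBdd (x : ℕ) (φ : Fml L) : Prop :=
  ∃ (t : FTerm L) (ψ : Fml L), x ∉ tvars t ∧ φ = or (neg (le (.var x) t)) ψ

/-- Quantifier-free formulas: all quantifiers are bounded. -/
def QF : Fml L → Prop
  | eq _ _ => True
  | rel _ _ => True
  | neg φ => QF φ
  | or φ ψ => QF φ ∧ QF ψ
  | all x φ => IsBdd x φ ∧ QF φ

/-- Universal formulas: a quantifier-free formula prefixed with universal quantifiers. -/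
inductive IsUniversal : Fml L → Prop
  | qf {φ : Fml L} : QF φ → IsUniversal φ
  | all {φ : Fml L} (x : ℕ) : IsUniversal φ → IsUniversal (all x φ)

end Fml

/-- All function symbols of the term are arithmetical. -/
def tIsAr : FTerm L → Prop
  | .var _ => True
  | .func f ts => (Sum.isLeft f = true) ∧ ∀ i, tIsAr (ts i)

/-- All symbols of the formula are arithmetical. -/
def Fml.IsAr : Fml L → Prop
  | .eq t s => tIsAr t ∧ tIsAr s
  | .rel R ts => (Sum.isLeft R = true) ∧ ∀ i, tIsAr (ts i)
  | .neg φ => φ.IsAr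
  | .or φ ψ => φ.IsAr ∧ ψ.IsAr
  | .all _ φ => φ.IsAr

/-- Truth of a formula in a structure with universe `ℕ`, under a valuation. -/
def Fml.Holds (M : (sig L).Structure ℕ) : Fml L → (ℕ → ℕ) → Prop
  | .eq t s, e => t.realize e = s.realize e
  | .rel R ts, e => M.RelMap R (fun i => (ts i).realize e)
  | .neg φ, e => ¬ φ.Holds M e
  | .or φ ψ, e => φ.Holds M e ∨ ψ.Holds M e
  | .all x φ, e => ∀ a : ℕ, φ.Holds M (Function.update e x a)

/-! ### Provability -/

/-- `x₁ = y₁ → (⋯ → (xₙ = yₙ → φ))`. -/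
def eqImp : {n : ℕ} → (x y : Fin n → ℕ) → Fml L → Fml L
  | 0, _, _, φ => φ
  | _ + 1, x, y, φ =>
      Fml.imp (.eq (.var (x 0)) (.var (y 0))) (eqImp (Fin.tail x) (Fin.tail y) φ)

/-- The equality axioms: reflexivity, and congruence for function symbols, for relation symbols
and for equality itself. -/
inductive EqAx : Fml L → Prop
  | refl (x : ℕ) : EqAx (.eq (.var x) (.var x))
  | func {n : ℕ} (f : (sig L).Functions n) (x y : Fin n → ℕ) :
      EqAx (eqImp x y (.eq (.func f fun i => .var (x i)) (.func f fun i => .var (y i))))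
  | rel {n : ℕ} (R : (sig L).Relations n) (x y : Fin n → ℕ) :
      EqAx (eqImp x y (Fml.imp (.rel R fun i => .var (x i)) (.rel R fun i => .var (y i))))
  | eq (x y : Fin 2 → ℕ) :
      EqAx (eqImp x y
        (Fml.imp (.eq (.var (x 0)) (.var (x 1))) (.eq (.var (y 0)) (.var (y 1)))))

/-- Provability in classical first-order logic from a set of non-logical axioms. -/
inductive Prov (T : Set (Fml L)) : Fml L → Prop
  | ax {φ : Fml L} : φ ∈ T → Prov T φ
  | em (φ : Fml L) : Prov T (.or (.neg φ) φ)
  | inst (x : ℕ) (t : FTerm L) (φ : Fml L) : φ.FreeFor x t →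
      Prov T (Fml.imp (.all x φ) (φ.subst x t))
  | eqAx {φ : Fml L} : EqAx φ → Prov T φ
  | expand {φ : Fml L} (ψ : Fml L) : Prov T φ → Prov T (.or φ ψ)
  | contr {φ : Fml L} : Prov T (.or φ φ) → Prov T φ
  | assoc {φ ψ χ : Fml L} : Prov T (.or (.or φ ψ) χ) → Prov T (.or φ (.or ψ χ))
  | cut {φ ψ χ : Fml L} : Prov T (.or φ ψ) → Prov T (.or (.neg φ) χ) → Prov T (.or ψ χ)
  | gen {φ ψ : Fml L} (x : ℕ) : x ∉ ψ.FV → Prov T (.or φ ψ) → Prov T (.or (.all x φ) ψ)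

/-- `∀ x₀ ⋯ ∀ xₙ₋₁ φ`, the variables being `0, …, n - 1`. -/
def closeN : ℕ → Fml L → Fml L
  | 0, φ => φ
  | n + 1, φ => closeN n (.all n φ)

/-- The variables `x₀, …, xₙ₋₁` as terms. -/
def xs (n : ℕ) : Fin n → FTerm L := fun i => .var i.val

/-- Peano arithmetic over the signature, with induction for all formulas. -/
inductive PA : Fml L → Prop
  | succ_ne_zero : PA (.all 0 (.neg (.eq (succT (.var 0)) zeroT)))
  | succ_inj : PA (.all 0 (.all 1 (Fml.imp (.eq (succT (.var 0)) (succT (.var 1)))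
      (.eq (.var 0) (.var 1)))))
  | not_lt_zero : PA (.all 0 (.neg (Fml.lt (.var 0) zeroT)))
  | lt_succ : PA (.all 0 (.all 1 (Fml.iff (Fml.lt (.var 0) (succT (.var 1)))
      (Fml.le (.var 0) (.var 1)))))
  | proj {n : ℕ} (i : Fin n) : PA (closeN n (.eq (prT (.proj i) (xs n)) (xs n i)))
  | comp {n k : ℕ} (g : PR k) (h : Fin k → PR n) :
      PA (closeN n (.eq (prT (.comp g h) (xs n)) (prT g fun j => prT (h j) (xs n))))
  | prec_zero {n : ℕ} (g : PR n) (h : PR (n + 2)) :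
      PA (closeN n (.eq (prT (.prec g h) (Fin.cons zeroT (xs n))) (prT g (xs n))))
  | prec_succ {n : ℕ} (g : PR n) (h : PR (n + 2)) :
      PA (closeN (n + 1) (.eq (prT (.prec g h) (Fin.cons (succT (.var n)) (xs n)))
        (prT h (Fin.cons (.var n)
          (Fin.cons (prT (.prec g h) (Fin.cons (.var n) (xs n))) (xs n))))))
  | ind (x : ℕ) (φ : Fml L) :
      PA (Fml.imp
        (Fml.and (φ.subst x zeroT) (.all x (Fml.imp φ (φ.subst x (succT (.var x))))))
        (.all x φ))

/-! ### Finite types -/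

/-- Finite types. -/
inductive Ty : Type
  | o : Ty
  | arrow (ρ τ : Ty) : Ty

/-- `(ρ₁, …, ρₙ) → τ = ρ₁ → (⋯ → (ρₙ → τ))`. -/
@[reducible] def Ty.arrows : List Ty → Ty → Ty
  | [], τ => τ
  | ρ :: l, τ => .arrow ρ (Ty.arrows l τ)

/-- `(ρ₁, …, ρₙ) → (τ₁, …, τₘ)`, the tuple of the types `(ρ₁, …, ρₙ) → τⱼ`. -/
abbrev Ty.arrowT (l m : List Ty) : List Ty := m.map (Ty.arrows l)

/-- The type `0ⁿ → 0`. -/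
@[reducible] def Ty.arr : ℕ → Ty
  | 0 => .o
  | n + 1 => .arrow .o (Ty.arr n)

/-- The full set-theoretic functionals of each type over `ℕ`. -/
@[reducible] def Ty.den : Ty → Type
  | .o => ℕ
  | .arrow ρ τ => ρ.den → τ.den

/-- Currying of a numerical function. -/
def curryN : (n : ℕ) → ((Fin n → ℕ) → ℕ) → (Ty.arr n).den
  | 0, F => F Fin.elim0
  | n + 1, F => fun (a : ℕ) => curryN n (fun v => F (Fin.cons a v))

/-! ### Infinitary terms

Terms are taken up to renaming of bound variables: free variables are named (for each type `ρ`,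
the variables of type `ρ` are the natural numbers, those of type `0` being the first-order
variables), and bound variables are de Bruijn variables in a context. The `ω`-terms proper are
those in the empty context. -/

/-- Bound variables of type `ρ` in a context. -/
inductive Var : List Ty → Ty → Type
  | zero {Γ : List Ty} {ρ : Ty} : Var (ρ :: Γ) ρ
  | succ {Γ : List Ty} {ρ τ : Ty} (x : Var Γ ρ) : Var (τ :: Γ) ρ

/-- The symbols for primitive recursive functions, other than `0` and `S`. -/
def IsPRSym : {n : ℕ} → (sig L).Functions n → Prop
  | _, Sum.inl PR.zero => False
  | _, Sum.inl PR.succ => False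
  | _, Sum.inl _ => True
  | _, Sum.inr _ => False

/-- The infinitary terms of each type in a context. -/
inductive Tm (L : FirstOrder.Language.{u, v}) : List Ty → Ty → Type (max u v)
  | fvar {Γ : List Ty} (ρ : Ty) (x : ℕ) : Tm L Γ ρ
  | bvar {Γ : List Ty} {ρ : Ty} (x : Var Γ ρ) : Tm L Γ ρ
  /-- The constant of a function symbol that is not a primitive recursive function symbol. -/
  | con {Γ : List Ty} {n : ℕ} (f : (sig L).Functions n) (hf : ¬ IsPRSym f) : Tm L Γ (Ty.arr n)
  /-- The case distinction constant of a quantifier-free formula with a non-arithmetical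
  symbol. -/
  | cas {Γ : List Ty} (φ : Fml L) (hq : φ.QF) (hn : ¬ φ.IsAr) :
      Tm L Γ (Ty.arr (φ.fvs.length + 2))
  | lam {Γ : List Ty} {ρ τ : Ty} (t : Tm L (ρ :: Γ) τ) : Tm L Γ (.arrow ρ τ)
  | app {Γ : List Ty} {ρ τ : Ty} (t : Tm L Γ (.arrow ρ τ)) (s : Tm L Γ ρ) : Tm L Γ τ
  /-- The infinite term `(tₙ)ₙ`. -/
  | seq {Γ : List Ty} {ρ : Ty} (t : ℕ → Tm L Γ ρ) : Tm L Γ (.arrow .o ρ)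

/-- The free variables of a term, each together with its type. -/
def Tm.FV : {Γ : List Ty} → {τ : Ty} → Tm L Γ τ → Set (Ty × ℕ)
  | _, _, .fvar ρ x => {(ρ, x)}
  | _, _, .bvar _ => ∅
  | _, _, .con _ _ => ∅
  | _, _, .cas _ _ _ => ∅
  | _, _, .lam t => t.FV
  | _, _, .app t s => t.FV ∪ s.FV
  | _, _, .seq t => ⋃ n, (t n).FV

/-- Extension of a renaming of contexts under a binder. -/
def liftRen {Γ Δ : List Ty} (r : ∀ ρ, Var Γ ρ → Var Δ ρ) (σ : Ty) :
    ∀ ρ, Var (σ :: Γ) ρ → Var (σ :: Δ) ρ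
  | _, .zero => .zero
  | _, .succ x => .succ (r _ x)

/-- Renaming of the bound variables of the context. -/
def Tm.ren : {Γ : List Ty} → {τ : Ty} → Tm L Γ τ →
    {Δ : List Ty} → (∀ ρ, Var Γ ρ → Var Δ ρ) → Tm L Δ τ
  | _, _, .fvar ρ x, _, _ => .fvar ρ x
  | _, _, .bvar x, _, r => .bvar (r _ x)
  | _, _, .con f hf, _, _ => .con f hf
  | _, _, .cas φ hq hn, _, _ => .cas φ hq hn
  | _, _, .lam t, _, r => .lam (t.ren (liftRen r _))
  | _, _, .app t s, _, r => .app (t.ren r) (s.ren r)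
  | _, _, .seq t, _, r => .seq (fun n => (t n).ren r)

/-- Weakening by one variable. -/
def Tm.up {Γ : List Ty} {τ : Ty} (t : Tm L Γ τ) (σ : Ty) : Tm L (σ :: Γ) τ :=
  t.ren (fun _ x => x.succ)

/-! ### Recursors and the embedding of first-order terms -/

/-- The constants `0` and `S`. -/
def Tm.zero {Γ : List Ty} : Tm L Γ .o := .con (n := 0) (Sum.inl PR.zero) (fun h => h)

def Tm.succ {Γ : List Ty} : Tm L Γ (.arrow .o .o) := .con (n := 1) (Sum.inl PR.succ) (fun h => h)

/-- The numeral `S ⋯ S 0`. -/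
def Tm.num {Γ : List Ty} : ℕ → Tm L Γ .o
  | 0 => .zero
  | n + 1 => .app .succ (Tm.num n)

/-- The terms `t₀ = a`, `tₙ₊₁ = b n tₙ`. -/
def Tm.recSeq {Γ : List Ty} {ρ : Ty} (a : Tm L Γ ρ) (b : Tm L Γ (.arrow .o (.arrow ρ ρ))) :
    ℕ → Tm L Γ ρ
  | 0 => a
  | n + 1 => .app (.app b (Tm.num n)) (Tm.recSeq a b n)

/-- The recursor `R_{a,b}`. -/
def Tm.R {Γ : List Ty} {ρ : Ty} (a : Tm L Γ ρ) (b : Tm L Γ (.arrow .o (.arrow ρ ρ))) :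
    Tm L Γ (.arrow .o ρ) := .seq (Tm.recSeq a b)

/-- `t s₁ ⋯ sₙ`. -/
def Tm.appN {Γ : List Ty} : {n : ℕ} → Tm L Γ (Ty.arr n) → (Fin n → Tm L Γ .o) → Tm L Γ .o
  | 0, t, _ => t
  | n + 1, t, s => Tm.appN (n := n) (.app t (s 0)) (Fin.tail s)

/-- The context extended by `n` variables of type `0`. -/
@[reducible] def pushN : ℕ → List Ty → List Ty
  | 0, Γ => Γ
  | n + 1, Γ => pushN n (.o :: Γ)

def pushVar : (n : ℕ) → {Γ : List Ty} → {ρ : Ty} → Var Γ ρ → Var (pushN n Γ) ρ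
  | 0, _, _, x => x
  | n + 1, _, _, x => pushVar n (Var.succ x)

/-- The `n` new variables of the context `pushN n Γ`, outermost first. -/
def argVar : (n : ℕ) → {Γ : List Ty} → Fin n → Var (pushN n Γ) .o
  | 0, _, i => i.elim0
  | n + 1, Γ, i => Fin.cases (pushVar n (Var.zero (Γ := Γ))) (fun j => argVar n j) i

/-- `λ x₁. ⋯ λ xₙ. t`. -/
def Tm.lamN : (n : ℕ) → {Γ : List Ty} → Tm L (pushN n Γ) .o → Tm L Γ (Ty.arr n)
  | 0, _, t => t
  | n + 1, _, t => .lam (Tm.lamN n t)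

/-- The variables `x₁, …, xₙ` bound by `Tm.lamN n`. -/
def Tm.args (n : ℕ) {Γ : List Ty} : Fin n → Tm L (pushN n Γ) .o := fun i => .bvar (argVar n i)

/-- The closed term of type `0ⁿ → 0` of a primitive recursive function symbol. -/
def PR.tm : {n : ℕ} → PR n → (Γ : List Ty) → Tm L Γ (Ty.arr n)
  | _, .zero, _ => .zero
  | _, .succ, _ => .succ
  | n, .proj i, _ => .lamN n (Tm.args n i)
  | n, .comp g h, Γ =>
      .lamN n (Tm.appN (g.tm (pushN n Γ))
        (fun j => Tm.appN ((h j).tm (pushN n Γ)) (Tm.args n)))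
  | _, .prec (n := n) g h, Γ =>
      .lamN (n + 1) (.app
        (Tm.R (Tm.appN (g.tm (pushN (n + 1) Γ)) (Fin.tail (Tm.args (n + 1))))
          (.lam (.lam (Tm.appN (h.tm (.o :: .o :: pushN (n + 1) Γ))
            (Fin.cons (.bvar (.succ .zero)) (Fin.cons (.bvar .zero)
              (fun i => ((Fin.tail (Tm.args (n + 1)) i).up .o).up .o)))))))
        (Tm.args (n + 1) 0))

/-- The term of type `0ⁿ → 0` of a function symbol. -/
def symTm (Γ : List Ty) : {n : ℕ} → (sig L).Functions n → Tm L Γ (Ty.arr n)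
  | _, Sum.inl p => PR.tm p Γ
  | _, Sum.inr f => .con (Sum.inr f) (fun h => h)

/-- The embedding of first-order terms, the first-order variables being replaced according to
`v`. -/
def iota {Γ : List Ty} (v : ℕ → Tm L Γ .o) : FTerm L → Tm L Γ .o
  | .var x => v x
  | .func f ts => Tm.appN (symTm Γ f) (fun i => iota v (ts i))

/-! ### Tuples of terms -/

/-- Term-tuples of a given type-tuple. -/
@[reducible] def Tup (L : FirstOrder.Language.{u, v}) (Γ : List Ty) : List Ty → Type (max u v)
  | [] => PUnit
  | ρ :: l => Tm L Γ ρ × Tup L Γ l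

def Tup.FV {Γ : List Ty} : {l : List Ty} → Tup L Γ l → Set (Ty × ℕ)
  | [], _ => ∅
  | _ :: _, t => t.1.FV ∪ Tup.FV t.2

def Tup.ren {Γ Δ : List Ty} (r : ∀ ρ, Var Γ ρ → Var Δ ρ) :
    {l : List Ty} → Tup L Γ l → Tup L Δ l
  | [], _ => PUnit.unit
  | _ :: _, t => (t.1.ren r, Tup.ren r t.2)

def Tup.up {Γ l : List Ty} (t : Tup L Γ l) (σ : Ty) : Tup L (σ :: Γ) l :=
  t.ren (fun _ x => x.succ)

/-- The first and the second part of a concatenation of tuples. -/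
def Tup.left {Γ : List Ty} : (l : List Ty) → {m : List Ty} → Tup L Γ (l ++ m) → Tup L Γ l
  | [], _, _ => PUnit.unit
  | _ :: l, _, t => (t.1, Tup.left l t.2)

def Tup.right {Γ : List Ty} : (l : List Ty) → {m : List Ty} → Tup L Γ (l ++ m) → Tup L Γ m
  | [], _, t => t
  | _ :: l, _, t => Tup.right l t.2

/-- `t v₁ ⋯ vₙ`. -/
def Tm.apps {Γ : List Ty} : {l : List Ty} → {τ : Ty} →
    Tm L Γ (Ty.arrows l τ) → Tup L Γ l → Tm L Γ τ
  | [], _, t, _ => t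
  | _ :: _, _, t, v => Tm.apps (.app t v.1) v.2

/-- Application of a tuple to a tuple: `(t₁, …, tₘ) v = (t₁ v, …, tₘ v)`. -/
def Tup.ap {Γ l : List Ty} : {m : List Ty} →
    Tup L Γ (Ty.arrowT l m) → Tup L Γ l → Tup L Γ m
  | [], _, _ => PUnit.unit
  | _ :: _, t, v => (Tm.apps t.1 v, Tup.ap (m := _) t.2 v)

/-- The variables of the context `l ++ Γ` that belong to `l`. -/
def Tup.vars {Γ : List Ty} : (l : List Ty) → Tup L (l ++ Γ) l
  | [] => PUnit.unit
  | ρ :: l => (.bvar .zero, (Tup.vars l).up ρ)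

/-- Weakening of variables from `Γ` to `l ++ Γ`. -/
def weak {Γ : List Ty} : (l : List Ty) → ∀ ρ, Var Γ ρ → Var (l ++ Γ) ρ
  | [], _, x => x
  | _ :: l, ρ, x => .succ (weak l ρ x)

/-! ### Formulas over infinitary terms -/

/-- The `ω`-formulas in a context, with equality of type `0` only. -/
inductive OFml (L : FirstOrder.Language.{u, v}) : List Ty → Type (max u v)
  | eq {Γ : List Ty} (t s : Tm L Γ .o) : OFml L Γ
  | rel {Γ : List Ty} {k : ℕ} (R : (sig L).Relations k) (ts : Fin k → Tm L Γ .o) : OFml L Γ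
  | neg {Γ : List Ty} (A : OFml L Γ) : OFml L Γ
  | or {Γ : List Ty} (A B : OFml L Γ) : OFml L Γ
  | all {Γ : List Ty} (ρ : Ty) (A : OFml L (ρ :: Γ)) : OFml L Γ

/-- Universal quantification over all the variables in `l` (a block of like quantifiers). -/
def OFml.alls {Γ : List Ty} : (l : List Ty) → OFml L (l ++ Γ) → OFml L Γ
  | [], A => A
  | ρ :: l, A => OFml.alls l (.all ρ A)

/-! ### Semantics -/

/-- Higher-type valuations of the free variables. -/
abbrev Valuation := ∀ ρ : Ty, ℕ → ρ.den

/-- Values of the bound variables of a context. -/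
abbrev CtxVal (Γ : List Ty) := ∀ ρ : Ty, Var Γ ρ → ρ.den

def CtxVal.cons {Γ : List Ty} {σ : Ty} (a : σ.den) (g : CtxVal Γ) : CtxVal (σ :: Γ)
  | _, .zero => a
  | _, .succ x => g _ x

def CtxVal.nil : CtxVal [] := fun _ x => nomatch x

/-- The valuation `e` modified to take the values `a` at the variables `x₁, …, xₘ`. -/
def updList (e : ℕ → ℕ) (x : List ℕ) (a : Fin x.length → ℕ) : ℕ → ℕ :=
  fun y => if h : y ∈ x then a ⟨x.idxOf y, List.idxOf_lt_length_iff.2 h⟩ else e y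

open Classical in
/-- The value of an infinitary term. -/
noncomputable def Tm.val (M : (sig L).Structure ℕ) (e : Valuation) :
    {Γ : List Ty} → {τ : Ty} → Tm L Γ τ → CtxVal Γ → τ.den
  | _, _, .fvar ρ x, _ => e ρ x
  | _, _, .bvar x, g => g _ x
  | _, _, .con f _, _ => curryN _ (fun a => M.funMap f a)
  | _, _, .cas φ _ _, _ =>
      curryN (φ.fvs.length + 2) (fun a =>
        if φ.Holds M (updList (e .o) φ.fvs (fun i => a (i.castAdd 2)))
        then a (Fin.natAdd φ.fvs.length (0 : Fin 2))
        else a (Fin.natAdd φ.fvs.length (1 : Fin 2)))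
  | _, _, .lam t, g => fun a => t.val M e (g.cons a)
  | _, _, .app t s, g => (t.val M e g) (s.val M e g)
  | _, _, .seq t, g => fun (n : ℕ) => (t n).val M e g

/-- Truth of an `ω`-formula. -/
def OFml.Holds (M : (sig L).Structure ℕ) (e : Valuation) :
    {Γ : List Ty} → OFml L Γ → CtxVal Γ → Prop
  | _, .eq t s, g => t.val M e g = s.val M e g
  | _, .rel R ts, g => M.RelMap R (fun i => (ts i).val M e g)
  | _, .neg A, g => ¬ A.Holds M e g
  | _, .or A B, g => A.Holds M e g ∨ B.Holds M e g
  | _, .all ρ A, g => ∀ a : ρ.den, A.Holds M e (g.cons a)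

/-! ### The Shoenfield interpretation -/

open Classical in
/-- The type-tuples of the tuples of variables `u_φ` (first component) and `x_φ` (second
component). For a bounded quantification `∀ z ≤ t ψ` with `x_ψ` empty, the tuples are those
of `ψ`; in all other cases of a quantification `∀ z ψ`, the variable `z` is added to `u_ψ`.
Since `∀ z ≤ t ψ` is `∀ z (¬ z ≤ t ∨ ψ)`, and the matrix `¬ z ≤ t ∨ ψ` has the same tuples as
`ψ`, both clauses are stated in terms of the matrix. Without the emptiness condition the
provable sentence `∀ z ≤ S0 ∃ y (y = z)` would require one `y` for all `z ≤ S0`. -/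
noncomputable def Fml.tp : Fml L → List Ty × List Ty
  | .eq _ _ => ([], [])
  | .rel _ _ => ([], [])
  | .neg ψ => (Ty.arrowT ψ.tp.1 ψ.tp.2, ψ.tp.1)
  | .or ψ χ => (ψ.tp.1 ++ χ.tp.1, ψ.tp.2 ++ χ.tp.2)
  | .all z ψ => if Fml.IsBdd z ψ ∧ ψ.tp.2 = [] then ψ.tp else (.o :: ψ.tp.1, ψ.tp.2)

open Classical in
/-- The formula `φ_Sh[u_φ := us, x_φ := xs]`, the free variables of `φ` being moreover replaced
according to `v`; `φ_Sh` itself is the case in which `us`, `xs` and `v` consist of distinct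
variables. -/
noncomputable def Fml.sh : (φ : Fml L) → {Γ : List Ty} → (v : ℕ → Tm L Γ .o) →
    (us : Tup L Γ φ.tp.1) → (xs : Tup L Γ φ.tp.2) → OFml L Γ
  | .eq t s, _, v, _, _ => .eq (iota v t) (iota v s)
  | .rel R ts, _, v, _, _ => .rel R (fun i => iota v (ts i))
  | .neg ψ, _, v, us, xs => .neg (ψ.sh v xs (Tup.ap us xs))
  | .or ψ χ, _, v, us, xs =>
      .or (ψ.sh v (Tup.left ψ.tp.1 us) (Tup.left ψ.tp.2 xs))
        (χ.sh v (Tup.right ψ.tp.1 us) (Tup.right ψ.tp.2 xs))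
  | .all z ψ, Γ, v, us, xs =>
      if h : Fml.IsBdd z ψ ∧ ψ.tp.2 = [] then
        have e : (Fml.all z ψ).tp = ψ.tp := if_pos h
        .all .o (ψ.sh
          (fun y => if y = z then .bvar .zero else (v y).up .o)
          (Tup.up (cast (congrArg (fun p => Tup L Γ p.1) e) us) .o)
          (Tup.up (cast (congrArg (fun p => Tup L Γ p.2) e) xs) .o))
      else
        have e : (Fml.all z ψ).tp = (.o :: ψ.tp.1, ψ.tp.2) := if_neg h
        let us' : Tup L Γ (.o :: ψ.tp.1) := cast (congrArg (fun p => Tup L Γ p.1) e) us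
        ψ.sh (fun y => if y = z then us'.1 else v y) us'.2
          (cast (congrArg (fun p => Tup L Γ p.2) e) xs)

/-- The `ω`-formula `∀ u_φ (φ_Sh[x_φ := t u_φ])`. -/
noncomputable def Fml.shAll (φ : Fml L) (t : Tup L [] (Ty.arrowT φ.tp.1 φ.tp.2)) : OFml L [] :=
  OFml.alls φ.tp.1 (φ.sh (fun x => .fvar .o x) (Tup.vars φ.tp.1)
    (Tup.ap (t.ren (weak φ.tp.1)) (Tup.vars φ.tp.1)))

end ShInt

/-! A formula is read as a problem "for all `u` find `x`", and a solution is a functional taking `u`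
to `x` that is given by terms, uniformly in the model and the valuation. The argument is an
induction on derivations, carried out semantically. A `World` is a model with standard arithmetic,
together with a valuation; `Def F` says that `F` is the value of a tuple of terms. Closure of `Def`
under pairing, abstraction, application, change of the valuation at a first-order variable and
infinite sequences replaces the manipulation of terms.

Infinite terms have two effects. A function of a natural number is definable as soon as its value at
each fixed number is (`Def.seq`), so recursions over `ℕ` need only a meta-level induction. Together
with the case distinction constants, they make the relation expressed by `φ_Sh` decidable by terms.
Decidability is what contraction needs, to choose between two candidate replies, and what induction
needs: solutions of the step are iterated upwards from the base (`Prob.indSol`), and a failure of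
the result is traced downwards to a failing base case or step (`Prob.indRef_spec`).

The induction on derivations (`Fml.realized_of_prov`) uses the variant `Fml.prob`, in which every
quantifier counts as unbounded, so that the quantifier rules need no distinction of cases. By
`Fml.equi_shProb` it is mutually reducible with the actual interpretation: if `ψ` asks for no reply,
a counterexample to `∀ z ≤ t ψ` can be found by bounded search. The axioms in `Γ` use the reduction
in the other direction, since a universal formula asks for no reply in the actual interpretation.
Finally, free variables of the terms that are not free in `φ` are replaced by zero functionals; this
is harmless because `φ_Sh` depends on the valuation only at the free variables of `φ`. -/

namespace ShInt

variable {L : FirstOrder.Language.{u, v}}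

/-! ### Values of terms -/

/-- Pulling values of bound variables back along a renaming. -/
def CtxVal.pull {Γ Δ : List Ty} (g : CtxVal Δ) (r : ∀ ρ, Var Γ ρ → Var Δ ρ) : CtxVal Γ :=
  fun ρ x => g ρ (r ρ x)

theorem CtxVal.cons_pull_liftRen {Γ Δ : List Ty} (g : CtxVal Δ) (r : ∀ ρ, Var Γ ρ → Var Δ ρ)
    {σ : Ty} (a : σ.den) : (g.cons a).pull (liftRen r σ) = (g.pull r).cons a := by
  funext ρ x; cases x <;> rfl

theorem Tm.val_ren (M : (sig L).Structure ℕ) (e : Valuation) {Γ : List Ty} {τ : Ty}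
    (t : Tm L Γ τ) : ∀ {Δ : List Ty} (r : ∀ ρ, Var Γ ρ → Var Δ ρ) (g : CtxVal Δ),
      (t.ren r).val M e g = t.val M e (g.pull r) := by
  induction t with
  | fvar | bvar | con | cas => intros; rfl
  | lam t ih =>
    intro Δ r g; funext a
    simp only [Tm.ren, Tm.val]
    rw [ih, CtxVal.cons_pull_liftRen]
  | app t s iht ihs => intro Δ r g; simp only [Tm.ren, Tm.val]; rw [iht, ihs]
  | seq t ih => intro Δ r g; funext n; simp only [Tm.ren, Tm.val]; rw [ih]

theorem Tm.val_up (M : (sig L).Structure ℕ) (e : Valuation) {Γ : List Ty} {τ σ : Ty}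
    (t : Tm L Γ τ) (a : σ.den) (g : CtxVal Γ) : (t.up σ).val M e (g.cons a) = t.val M e g :=
  t.val_ren M e _ _

theorem Tm.FV_ren {Γ : List Ty} {τ : Ty} (t : Tm L Γ τ) :
    ∀ {Δ : List Ty} (r : ∀ ρ, Var Γ ρ → Var Δ ρ), (t.ren r).FV = t.FV := by
  induction t with
  | fvar | bvar | con | cas => intros; rfl
  | lam t ih => intro Δ r; exact ih _
  | app t s iht ihs => intro Δ r; simp only [Tm.ren, Tm.FV, iht, ihs]
  | seq t ih => intro Δ r; simp only [Tm.ren, Tm.FV, ih]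

/-- A structure whose arithmetical reduct is the standard one. -/
def Standard (M : (sig L).Structure ℕ) : Prop :=
  @FirstOrder.Language.LHom.reduct arith (sig L) FirstOrder.Language.LHom.sumInl ℕ M = stdN

theorem Standard.funMap {M : (sig L).Structure ℕ} (h : Standard M) {n : ℕ} (f : PR n)
    (a : Fin n → ℕ) : M.funMap (Sum.inl f : (sig L).Functions n) a = f.eval a :=
  congrArg (fun S : arith.Structure ℕ => S.funMap (n := n) f a) h

theorem Standard.relMap_lt {M : (sig L).Structure ℕ} (h : Standard M) (a : Fin 2 → ℕ) :
    M.RelMap (Sum.inl ArRel.lt : (sig L).Relations 2) a ↔ a 0 < a 1 :=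
  iff_of_eq (congrArg (fun S : arith.Structure ℕ => S.RelMap (n := 2) ArRel.lt a) h)

/-- The function `F` is supplied by a hypothesis because the head is always a term known to denote a
curried function: a constant, or the translation of a function symbol. -/
theorem Tm.val_appN (M : (sig L).Structure ℕ) (e : Valuation) {Γ : List Ty} (g : CtxVal Γ) :
    ∀ {n : ℕ} (t : Tm L Γ (Ty.arr n)) (s : Fin n → Tm L Γ .o) (F : (Fin n → ℕ) → ℕ),
      t.val M e g = curryN n F → (Tm.appN t s).val M e g = F (fun i => (s i).val M e g)
  | 0, t, s, F, h => h.trans (congrArg F (funext fun i => i.elim0))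
  | n + 1, t, s, F, h => by
    have h' : (Tm.app t (s 0)).val M e g
        = curryN n (fun v => F (Fin.cons ((s 0).val M e g) v)) := by
      simp only [Tm.val, h]; rfl
    refine (Tm.val_appN M e g (.app t (s 0)) (Fin.tail s) _ h').trans (congrArg F ?_)
    funext i
    cases i using Fin.cases <;> rfl

/-- The values of the context extended by `n` variables of type `0`. -/
def pushCtx : (n : ℕ) → {Γ : List Ty} → CtxVal Γ → (Fin n → ℕ) → CtxVal (pushN n Γ)
  | 0, _, g, _ => g
  | n + 1, _, g, a => pushCtx n (CtxVal.cons (σ := .o) (a 0) g) (Fin.tail a)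

theorem pushCtx_pushVar : ∀ (n : ℕ) {Γ : List Ty} (g : CtxVal Γ) (a : Fin n → ℕ) {ρ : Ty}
    (x : Var Γ ρ), pushCtx n g a _ (pushVar n x) = g _ x
  | 0, _, _, _, _, _ => rfl
  | n + 1, _, g, a, _, x => pushCtx_pushVar n (CtxVal.cons (σ := .o) (a 0) g) (Fin.tail a) x.succ

theorem pushCtx_argVar : ∀ (n : ℕ) {Γ : List Ty} (g : CtxVal Γ) (a : Fin n → ℕ) (i : Fin n),
    pushCtx n g a _ (argVar n i) = a i
  | n + 1, _, g, a, i => by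
    cases i using Fin.cases with
    | zero => exact pushCtx_pushVar n _ _ _
    | succ j => exact pushCtx_argVar n _ _ j

theorem Tm.val_lamN (M : (sig L).Structure ℕ) (e : Valuation) :
    ∀ (n : ℕ) {Γ : List Ty} (g : CtxVal Γ) (t : Tm L (pushN n Γ) .o),
      (Tm.lamN n t).val M e g = curryN n (fun a => t.val M e (pushCtx n g a))
  | 0, _, _, _ => rfl
  | n + 1, _, g, t => by
    funext a
    exact Tm.val_lamN M e n (CtxVal.cons (σ := .o) a g) t

theorem Tm.val_num {M : (sig L).Structure ℕ} (hM : Standard M) (e : Valuation) {Γ : List Ty}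
    (g : CtxVal Γ) : ∀ n : ℕ, (Tm.num n : Tm L Γ .o).val M e g = n
  | 0 => hM.funMap PR.zero _
  | n + 1 => by
    have h : (Tm.num (n + 1) : Tm L Γ .o).val M e g = (Tm.num n : Tm L Γ .o).val M e g + 1 :=
      hM.funMap PR.succ _
    rw [h, Tm.val_num hM e g n]

theorem Tm.val_recSeq {M : (sig L).Structure ℕ} (hM : Standard M) (e : Valuation) {Γ : List Ty}
    (g : CtxVal Γ) {ρ : Ty} (a : Tm L Γ ρ) (b : Tm L Γ (.arrow .o (.arrow ρ ρ))) (n : ℕ) :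
    (Tm.recSeq a b n).val M e g
      = Nat.rec (a.val M e g) (fun (k : ℕ) r => b.val M e g k r) n := by
  induction n with
  | zero => rfl
  | succ n ih => simp only [Tm.recSeq, Tm.val, ih, Tm.val_num hM]

theorem PR.val_tm {M : (sig L).Structure ℕ} (hM : Standard M) (e : Valuation) {n : ℕ}
    (f : PR n) : ∀ {Γ : List Ty} (g : CtxVal Γ),
      (PR.tm f Γ : Tm L Γ (Ty.arr n)).val M e g = curryN n f.eval := by
  induction f with
  | zero => intro Γ g; exact hM.funMap PR.zero _
  | succ => intro Γ g; funext a; exact hM.funMap PR.succ _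
  | proj i =>
    intro Γ g
    rw [PR.tm, Tm.val_lamN]
    congr 1; funext a
    exact pushCtx_argVar _ _ _ _
  | comp f h ihf ihh =>
    intro Γ g
    rw [PR.tm, Tm.val_lamN]
    congr 1; funext a
    rw [Tm.val_appN M e _ _ _ _ (ihf _), PR.eval]
    congr 1; funext j
    rw [Tm.val_appN M e _ _ _ _ (ihh j _)]
    congr 1; funext i
    exact pushCtx_argVar _ _ _ _
  | @prec n f h ihf ihh =>
    intro Γ g
    rw [PR.tm, Tm.val_lamN]
    congr 1; funext a
    have hargs : ∀ i : Fin (n + 1), (Tm.args (n + 1) i : Tm L (pushN (n + 1) Γ) .o).val M e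
        (pushCtx (n + 1) g a) = a i := fun i => pushCtx_argVar _ _ _ _
    rw [Tm.val, Tm.R, Tm.val, hargs]
    refine (Tm.val_recSeq hM e _ _ _ (a 0)).trans ?_
    rw [PR.eval]
    congr 1
    · rw [Tm.val_appN M e _ _ _ _ (ihf _)]
      congr 1; funext i
      exact hargs i.succ
    · funext k r
      simp only [Tm.val]
      rw [Tm.val_appN M e _ _ _ _ (ihh _)]
      congr 1; funext i
      cases i using Fin.cases with
      | zero => rfl
      | succ i =>
        cases i using Fin.cases with
        | zero => rfl
        | succ i =>
          simp only [Fin.cons_succ]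
          rw [Tm.val_up, Tm.val_up]
          exact hargs i.succ

theorem val_symTm {M : (sig L).Structure ℕ} (hM : Standard M) (e : Valuation) {Γ : List Ty}
    (g : CtxVal Γ) : ∀ {n : ℕ} (f : (sig L).Functions n),
      (symTm Γ f).val M e g = curryN n (fun a => M.funMap f a)
  | n, Sum.inl p => by
    refine (PR.val_tm hM e p g).trans ?_
    congr 1; funext a
    exact (hM.funMap p a).symm
  | _, Sum.inr f => rfl

theorem val_iota {M : (sig L).Structure ℕ} (hM : Standard M) (e : Valuation) {Γ : List Ty}
    (g : CtxVal Γ) (v : ℕ → Tm L Γ .o) (t : FTerm L) :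
    (iota v t).val M e g = t.realize (fun y => (v y).val M e g) := by
  induction t with
  | var x => rfl
  | func f ts ih =>
    rw [iota, Tm.val_appN M e g _ _ _ (val_symTm hM e g f)]
    simp only [ih]
    rfl

/-! ### Coincidence -/

theorem realize_congr (M : (sig L).Structure ℕ) (t : FTerm L) {v w : ℕ → ℕ}
    (h : ∀ x ∈ tvars t, v x = w x) : t.realize v = t.realize w := by
  induction t with
  | var x => exact h x (by simp [tvars])
  | func f ts ih =>
    simp only [FirstOrder.Language.Term.realize]
    congr 1; funext i
    refine ih i fun x hx => h x ?_
    simp only [tvars, List.mem_flatten, List.mem_ofFn]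
    exact ⟨_, ⟨i, rfl⟩, hx⟩

theorem realize_update_of_notMem (M : (sig L).Structure ℕ) (t : FTerm L) {v : ℕ → ℕ} {x : ℕ}
    (a : ℕ) (h : x ∉ tvars t) : t.realize (Function.update v x a) = t.realize v :=
  realize_congr M t fun y hy => Function.update_of_ne (fun (e : y = x) => h (e ▸ hy)) _ _

theorem Fml.mem_FV_rel {k : ℕ} {R : (sig L).Relations k} {ts : Fin k → FTerm L} {i : Fin k}
    {x : ℕ} (hx : x ∈ tvars (ts i)) : x ∈ (Fml.rel R ts).fvl := by
  simp only [fvl, List.mem_flatten, List.mem_ofFn]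
  exact ⟨_, ⟨i, rfl⟩, hx⟩

theorem Fml.holds_congr (M : (sig L).Structure ℕ) (φ : Fml L) :
    ∀ {v w : ℕ → ℕ}, (∀ x ∈ φ.fvl, v x = w x) → (φ.Holds M v ↔ φ.Holds M w) := by
  induction φ with
  | eq t s =>
    intro v w h
    simp only [Holds]
    rw [realize_congr M t fun x hx => h x (List.mem_append_left _ hx),
      realize_congr M s fun x hx => h x (List.mem_append_right _ hx)]
  | rel R ts =>
    intro v w h
    simp only [Holds]
    rw [show (fun i => (ts i).realize v) = fun i => (ts i).realize w from
      funext fun i => realize_congr M _ fun x hx => h x (mem_FV_rel hx)]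
  | neg φ ih => intro v w h; exact not_congr (ih h)
  | or φ ψ ihφ ihψ =>
    intro v w h
    exact or_congr (ihφ fun x hx => h x (List.mem_append_left _ hx))
      (ihψ fun x hx => h x (List.mem_append_right _ hx))
  | all y φ ih =>
    intro v w h
    refine forall_congr' fun a => ih fun x hx => ?_
    by_cases hxy : x = y
    · subst hxy; simp
    · rw [Function.update_of_ne hxy, Function.update_of_ne hxy]
      exact h x (by simp [fvl, hx, hxy])

/-! ### Substitution for free variables of infinitary terms -/

/-- Simultaneous substitution for the free variables, together with a renaming of the bound
variables of the context. -/
def Tm.fsub : {Γ : List Ty} → {τ : Ty} → Tm L Γ τ → {Δ : List Ty} →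
    (∀ ρ, Var Γ ρ → Var Δ ρ) → (∀ ρ, ℕ → Tm L Δ ρ) → Tm L Δ τ
  | _, _, .fvar ρ x, _, _, σ => σ ρ x
  | _, _, .bvar x, _, r, _ => .bvar (r _ x)
  | _, _, .con f hf, _, _, _ => .con f hf
  | _, _, .cas φ hq hn, _, _, _ => .cas φ hq hn
  | _, _, .lam t, _, r, σ => .lam (t.fsub (liftRen r _) (fun ρ x => (σ ρ x).up _))
  | _, _, .app t s, _, r, σ => .app (t.fsub r σ) (s.fsub r σ)
  | _, _, .seq t, _, r, σ => .seq (fun n => (t n).fsub r σ)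

theorem updList_of_mem (e e' : ℕ → ℕ) (x : List ℕ) (a : Fin x.length → ℕ) {y : ℕ} (h : y ∈ x) :
    updList e x a y = updList e' x a y := by
  simp [updList, h]

theorem Tm.val_fsub (M : (sig L).Structure ℕ) (e : Valuation) {Γ : List Ty} {τ : Ty}
    (t : Tm L Γ τ) : ∀ {Δ : List Ty} (r : ∀ ρ, Var Γ ρ → Var Δ ρ) (σ : ∀ ρ, ℕ → Tm L Δ ρ)
      (g : CtxVal Δ),
      (t.fsub r σ).val M e g = t.val M (fun ρ x => (σ ρ x).val M e g) (g.pull r) := by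
  induction t with
  | fvar | bvar | con => intros; rfl
  | cas φ hq hn =>
    intro Δ r σ g
    simp only [Tm.fsub, Tm.val]
    congr 1; funext a
    congr 1
    -- The valuation enters the value of a case distinction constant only as the default of
    -- `updList`, outside the list of free variables of `φ`; the truth of `φ` does not see it there.
    refine propext (φ.holds_congr M fun x hx => updList_of_mem _ _ _ _ ?_)
    simpa [Fml.fvs] using hx
  | lam t ih =>
    intro Δ r σ g; funext a
    simp only [Tm.fsub, Tm.val]
    rw [ih, CtxVal.cons_pull_liftRen]
    simp only [Tm.val_up]
  | app t s iht ihs => intro Δ r σ g; simp only [Tm.fsub, Tm.val]; rw [iht, ihs]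
  | seq t ih => intro Δ r σ g; funext n; simp only [Tm.fsub, Tm.val]; rw [ih]

theorem Tm.FV_fsub_subset {Γ : List Ty} {τ : Ty} (t : Tm L Γ τ) {S : Set (Ty × ℕ)} :
    ∀ {Δ : List Ty} (r : ∀ ρ, Var Γ ρ → Var Δ ρ) (σ : ∀ ρ, ℕ → Tm L Δ ρ),
      (∀ ρ x, (σ ρ x).FV ⊆ S) → (t.fsub r σ).FV ⊆ S := by
  induction t with
  | fvar ρ x => intro Δ r σ h; exact h ρ x
  | bvar | con | cas => intro Δ r σ h; exact Set.empty_subset _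
  | lam t ih => intro Δ r σ h; exact ih _ _ fun ρ x => ((σ ρ x).FV_ren _).trans_subset (h ρ x)
  | app t s iht ihs => intro Δ r σ h; exact Set.union_subset (iht r σ h) (ihs r σ h)
  | seq t ih => intro Δ r σ h; exact Set.iUnion_subset fun n => ih n r σ h

/-! ### Tuples of functionals -/

/-- Tuples of functionals of a given type-tuple. -/
@[reducible] def DTup : List Ty → Type
  | [] => Unit
  | ρ :: l => ρ.den × DTup l

/-- The values of the terms of a tuple. -/
noncomputable def Tup.val (M : (sig L).Structure ℕ) (e : Valuation) {Γ : List Ty} :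
    {l : List Ty} → Tup L Γ l → CtxVal Γ → DTup l
  | [], _, _ => ()
  | _ :: _, t, g => (t.1.val M e g, Tup.val M e t.2 g)

theorem Tup.val_ren (M : (sig L).Structure ℕ) (e : Valuation) {Γ Δ : List Ty}
    (r : ∀ ρ, Var Γ ρ → Var Δ ρ) (g : CtxVal Δ) : ∀ {l : List Ty} (t : Tup L Γ l),
      (t.ren r).val M e g = t.val M e (g.pull r)
  | [], _ => rfl
  | _ :: _, t => Prod.ext (t.1.val_ren M e r g) (Tup.val_ren M e r g t.2)

theorem Tup.val_up (M : (sig L).Structure ℕ) (e : Valuation) {Γ l : List Ty} {σ : Ty}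
    (t : Tup L Γ l) (a : σ.den) (g : CtxVal Γ) : (t.up σ).val M e (g.cons a) = t.val M e g :=
  Tup.val_ren M e _ _ t

namespace DTup

/-- Concatenation. -/
def append : {l m : List Ty} → DTup l → DTup m → DTup (l ++ m)
  | [], _, _, d => d
  | _ :: _, _, c, d => (c.1, append c.2 d)

/-- The first part of a concatenation. -/
def left : (l : List Ty) → {m : List Ty} → DTup (l ++ m) → DTup l
  | [], _, _ => ()
  | _ :: l, _, d => (d.1, left l d.2)

/-- The second part of a concatenation. -/
def right : (l : List Ty) → {m : List Ty} → DTup (l ++ m) → DTup m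
  | [], _, d => d
  | _ :: l, _, d => right l d.2

theorem left_append : ∀ {l m : List Ty} (c : DTup l) (d : DTup m), left l (append c d) = c
  | [], _, _, _ => rfl
  | _ :: _, _, c, d => Prod.ext rfl (left_append c.2 d)

theorem right_append : ∀ {l m : List Ty} (c : DTup l) (d : DTup m), right l (append c d) = d
  | [], _, _, _ => rfl
  | _ :: _, _, c, d => right_append c.2 d

theorem append_left_right : ∀ (l : List Ty) {m : List Ty} (d : DTup (l ++ m)),
    append (left l d) (right l d) = d
  | [], _, _ => rfl
  | _ :: l, _, d => Prod.ext rfl (append_left_right l d.2)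

/-- Application of a functional to a tuple. -/
def apps : {l : List Ty} → {τ : Ty} → (Ty.arrows l τ).den → DTup l → τ.den
  | [], _, f, _ => f
  | _ :: _, _, f, d => apps (f d.1) d.2

/-- Application of a tuple of functionals to a tuple. -/
def ap {l : List Ty} : {m : List Ty} → DTup (Ty.arrowT l m) → DTup l → DTup m
  | [], _, _ => ()
  | _ :: _, f, d => (apps f.1 d, ap (m := _) f.2 d)

/-- Currying of a functional of a tuple. -/
def curry : {l : List Ty} → {τ : Ty} → (DTup l → τ.den) → (Ty.arrows l τ).den
  | [], _, F => F ()
  | _ :: _, _, F => fun a => curry fun d => F (a, d)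

/-- Currying of a tuple-valued function of a tuple. -/
def abs {l : List Ty} : {m : List Ty} → (DTup l → DTup m) → DTup (Ty.arrowT l m)
  | [], _ => ()
  | _ :: _, F => (curry fun d => (F d).1, abs fun d => (F d).2)

theorem apps_curry : ∀ {l : List Ty} {τ : Ty} (F : DTup l → τ.den) (d : DTup l),
    apps (curry F) d = F d
  | [], _, _, _ => rfl
  | _ :: _, _, F, d => apps_curry (fun d' => F (d.1, d')) d.2

theorem curry_apps : ∀ {l : List Ty} {τ : Ty} (f : (Ty.arrows l τ).den),
    curry (fun d => apps f d) = f
  | [], _, _ => rfl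
  | _ :: _, _, f => funext fun a => curry_apps (f a)

theorem ap_abs {l : List Ty} : ∀ {m : List Ty} (F : DTup l → DTup m) (d : DTup l),
    ap (abs F) d = F d
  | [], _, _ => rfl
  | _ :: _, F, d => Prod.ext (apps_curry _ d) (ap_abs (fun d => (F d).2) d)

theorem abs_ap {l : List Ty} : ∀ {m : List Ty} (f : DTup (Ty.arrowT l m)), abs (ap f) = f
  | [], _ => rfl
  | _ :: _, f => Prod.ext (curry_apps f.1) (abs_ap (m := _) f.2)

end DTup

theorem Tup.val_left (M : (sig L).Structure ℕ) (e : Valuation) {Γ : List Ty} (g : CtxVal Γ) :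
    ∀ (l : List Ty) {m : List Ty} (t : Tup L Γ (l ++ m)),
      (Tup.left l t).val M e g = DTup.left l (t.val M e g)
  | [], _, _ => rfl
  | _ :: l, _, t => Prod.ext rfl (Tup.val_left M e g l t.2)

theorem Tup.val_right (M : (sig L).Structure ℕ) (e : Valuation) {Γ : List Ty} (g : CtxVal Γ) :
    ∀ (l : List Ty) {m : List Ty} (t : Tup L Γ (l ++ m)),
      (Tup.right l t).val M e g = DTup.right l (t.val M e g)
  | [], _, _ => rfl
  | _ :: l, _, t => Tup.val_right M e g l t.2

theorem Tm.val_apps (M : (sig L).Structure ℕ) (e : Valuation) {Γ : List Ty} (g : CtxVal Γ) :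
    ∀ {l : List Ty} {τ : Ty} (t : Tm L Γ (Ty.arrows l τ)) (s : Tup L Γ l),
      (Tm.apps t s).val M e g = DTup.apps (t.val M e g) (s.val M e g)
  | [], _, _, _ => rfl
  | _ :: _, _, t, s => Tm.val_apps M e g (.app t s.1) s.2

theorem Tup.val_ap (M : (sig L).Structure ℕ) (e : Valuation) {Γ l : List Ty} (g : CtxVal Γ) :
    ∀ {m : List Ty} (t : Tup L Γ (Ty.arrowT l m)) (s : Tup L Γ l),
      (Tup.ap t s).val M e g = DTup.ap (t.val M e g) (s.val M e g)
  | [], _, _ => rfl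
  | _ :: _, t, s => Prod.ext (Tm.val_apps M e g t.1 s) (Tup.val_ap M e g (m := _) t.2 s)

/-- The values of a context extended by a tuple. -/
def CtxVal.ext {Γ : List Ty} (g : CtxVal Γ) : {l : List Ty} → DTup l → CtxVal (l ++ Γ)
  | [], _ => g
  | _ :: _, d => (g.ext d.2).cons d.1

theorem CtxVal.ext_weak {Γ : List Ty} (g : CtxVal Γ) : ∀ {l : List Ty} (d : DTup l),
    (g.ext d).pull (weak l) = g
  | [], _ => rfl
  | _ :: _, d => g.ext_weak d.2

theorem Tup.val_vars (M : (sig L).Structure ℕ) (e : Valuation) {Γ : List Ty} (g : CtxVal Γ) :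
    ∀ {l : List Ty} (d : DTup l), (Tup.vars l).val M e (g.ext d) = d
  | [], _ => rfl
  | _ :: _, d => Prod.ext rfl ((Tup.val_up M e _ d.1 _).trans (Tup.val_vars M e g d.2))

theorem OFml.holds_alls (M : (sig L).Structure ℕ) (e : Valuation) {Γ : List Ty} (g : CtxVal Γ) :
    ∀ (l : List Ty) (A : OFml L (l ++ Γ)),
      (OFml.alls l A).Holds M e g ↔ ∀ d : DTup l, A.Holds M e (g.ext d)
  | [], _ => ⟨fun h _ => h, fun h => h ()⟩
  | _ :: l, _ => (OFml.holds_alls M e g l _).trans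
      ⟨fun h d => h d.2 d.1, fun h d a => h (a, d)⟩

/-! ### Definable functions -/

/-- A model of `T` extending the standard model of arithmetic, with a valuation. -/
structure World (T : Set (Fml L)) where
  M : (sig L).Structure ℕ
  std : Standard M
  sat : ∀ γ ∈ T, ∀ e : ℕ → ℕ, γ.Holds M e
  e : Valuation

/-- Modification of a valuation at a first-order variable. -/
def Valuation.upd (e : Valuation) (x a : ℕ) : Valuation
  | .o => Function.update (e .o) x a
  | .arrow ρ τ => e (.arrow ρ τ)

variable {T : Set (Fml L)}

/-- Modification of the valuation at a first-order variable. -/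
def World.upd (w : World T) (x a : ℕ) : World T := { w with e := Valuation.upd w.e x a }

/-- The values of the first-order variables. -/
abbrev World.v (w : World T) : ℕ → ℕ := w.e .o

theorem World.v_upd (w : World T) (x a : ℕ) : (w.upd x a).v = Function.update w.v x a := rfl

theorem World.ext_e {w w' : World T} (hM : w.M = w'.M) (he : w.e = w'.e) : w = w' := by
  cases w; cases w'; cases hM; cases he; rfl

theorem World.upd_upd (w : World T) (x a b : ℕ) : (w.upd x a).upd x b = w.upd x b := by
  refine World.ext_e rfl (funext fun ρ => ?_)
  cases ρ with
  | o => exact Function.update_idem _ _ _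
  | arrow => rfl

theorem World.upd_comm (w : World T) {x y : ℕ} (h : x ≠ y) (a b : ℕ) :
    (w.upd x a).upd y b = (w.upd y b).upd x a := by
  refine World.ext_e rfl (funext fun ρ => ?_)
  cases ρ with
  | o => exact Function.update_comm h _ _ _
  | arrow => rfl

/-- Functionals given by a term in a context. -/
def TDef {Γ : List Ty} {τ : Ty} (F : World T → CtxVal Γ → τ.den) : Prop :=
  ∃ t : Tm L Γ τ, ∀ (w : World T) (g : CtxVal Γ), t.val w.M w.e g = F w g

namespace TDef

variable {Γ Δ : List Ty} {ρ τ : Ty}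

theorem ren {F : World T → CtxVal Γ → τ.den} (h : TDef F) (r : ∀ ρ, Var Γ ρ → Var Δ ρ) :
    TDef (fun (w : World T) g => F w (g.pull r)) := by
  obtain ⟨t, ht⟩ := h
  exact ⟨t.ren r, fun w g => (t.val_ren _ _ r g).trans (ht w _)⟩

theorem bvar (x : Var Γ τ) : TDef (fun (_ : World T) g => g τ x) := ⟨.bvar x, fun _ _ => rfl⟩

theorem lam {F : World T → CtxVal (ρ :: Γ) → τ.den} (h : TDef F) :
    TDef (τ := .arrow ρ τ) (fun (w : World T) g => fun a : ρ.den => F w (g.cons a)) := by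
  obtain ⟨t, ht⟩ := h
  exact ⟨.lam t, fun w g => funext fun a => ht w _⟩

/-- The terms for the individual `n` may be chosen arbitrarily; the formation rule for infinite
terms asks for no uniformity between them. -/
theorem seq {F : World T → CtxVal Γ → ℕ → τ.den} (h : ∀ n, TDef (fun w g => F w g n)) :
    TDef (τ := .arrow .o τ) F := by
  choose t ht using h
  exact ⟨.seq t, fun w g => funext fun n => ht n w g⟩

theorem num (n : ℕ) : TDef (τ := .o) (fun (_ : World T) (_ : CtxVal Γ) => n) :=
  ⟨.num n, fun w g => Tm.val_num w.std w.e g n⟩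

/-- Evaluation under a modified valuation is the semantic form of substituting a term for the free
variable `z`. It turns a parameter of a solution into an argument, as the treatment of `∀ z`
requires. -/
theorem upd {F : World T → CtxVal Γ → τ.den} {s : World T → CtxVal Γ → ℕ} (z : ℕ)
    (hF : TDef F) (hs : TDef (τ := .o) s) : TDef (fun w g => F (w.upd z (s w g)) g) := by
  obtain ⟨t, ht⟩ := hF
  obtain ⟨s', hs'⟩ := hs
  let σ : ∀ ρ, ℕ → Tm L Γ ρ := fun ρ => match ρ with
    | .o => fun x => if x = z then s' else .fvar .o x
    | .arrow ρ τ => fun x => .fvar (.arrow ρ τ) x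
  refine ⟨t.fsub (fun _ x => x) σ, fun w g => ?_⟩
  rw [Tm.val_fsub]
  refine Eq.trans ?_ (ht (w.upd z (s w g)) g)
  have : (fun ρ x => (σ ρ x).val w.M w.e g) = (w.upd z (s w g)).e := by
    funext ρ x
    cases ρ with
    | arrow => rfl
    | o =>
      simp only [σ]
      split
      · rename_i h
        subst h
        exact (hs' w g).trans (Function.update_self x _ (w.e .o)).symm
      · rename_i h
        exact (Function.update_of_ne h _ (w.e .o)).symm
  rw [this]
  rfl

end TDef

/-- Weakening by a variable below a tuple of variables. -/
def weakUnder {Γ : List Ty} (σ : Ty) : (l : List Ty) → ∀ ρ, Var (l ++ Γ) ρ → Var (l ++ σ :: Γ) ρ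
  | [], _, x => x.succ
  | ρ :: l, _, x => liftRen (weakUnder σ l) ρ _ x

theorem CtxVal.ext_weakUnder {Γ : List Ty} {σ : Ty} (g : CtxVal (σ :: Γ)) :
    ∀ {l : List Ty} (d : DTup l),
      (g.ext d).pull (weakUnder σ l) = (g.pull (fun _ x => x.succ)).ext d
  | [], _ => rfl
  | _ :: _, d => (CtxVal.cons_pull_liftRen _ _ _).trans
      (congrArg (CtxVal.cons d.1) (g.ext_weakUnder d.2))

/-- Moving the first variable of a context below a tuple of variables. -/
def moveUnder {Γ : List Ty} (σ : Ty) (l : List Ty) :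
    ∀ ρ, Var (σ :: (l ++ Γ)) ρ → Var (l ++ σ :: Γ) ρ
  | _, .zero => weak l _ .zero
  | _, .succ x => weakUnder σ l _ x

theorem CtxVal.ext_moveUnder {Γ : List Ty} {σ : Ty} (g : CtxVal Γ) (a : σ.den) {l : List Ty}
    (d : DTup l) : ((g.cons a).ext d).pull (moveUnder σ l) = (g.ext d).cons a := by
  funext ρ x
  cases x with
  | zero =>
    exact congrFun (congrFun ((g.cons a).ext_weak d) σ) .zero
  | succ x =>
    exact congrFun (congrFun ((g.cons a).ext_weakUnder d) ρ) x

/-- The first variable of the tuple must be bound outermost, while in the context it is the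
innermost one; `moveUnder` exchanges it with the rest before the recursion. -/
theorem TDef.curry {τ : Ty} : ∀ {l Γ : List Ty} {F : World T → CtxVal (l ++ Γ) → τ.den},
    TDef F → TDef (fun (w : World T) (g : CtxVal Γ) => DTup.curry fun d : DTup l => F w (g.ext d))
  | [], _, _, h => h
  | σ :: l, Γ, F, h => by
    have := (TDef.curry (h.ren (moveUnder σ l))).lam
    simp only [CtxVal.ext_moveUnder] at this
    exact this

/-- Tuples of functionals given by a tuple of terms in a context. -/
def TupDef {Γ l : List Ty} (F : World T → CtxVal Γ → DTup l) : Prop :=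
  ∃ t : Tup L Γ l, ∀ (w : World T) (g : CtxVal Γ), t.val w.M w.e g = F w g

namespace TupDef

variable {Γ Δ : List Ty}

theorem nil {F : World T → CtxVal Γ → DTup []} : TupDef F := ⟨PUnit.unit, fun _ _ => rfl⟩

theorem cons {ρ : Ty} {l : List Ty} {F : World T → CtxVal Γ → DTup (ρ :: l)}
    (h₁ : TDef (fun w g => (F w g).1)) (h₂ : TupDef (fun w g => (F w g).2)) : TupDef F := by
  obtain ⟨t, ht⟩ := h₁
  obtain ⟨s, hs⟩ := h₂
  exact ⟨(t, s), fun w g => Prod.ext (ht w g) (hs w g)⟩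

theorem head {ρ : Ty} {l : List Ty} {F : World T → CtxVal Γ → DTup (ρ :: l)} (h : TupDef F) :
    TDef (fun w g => (F w g).1) := by
  obtain ⟨t, ht⟩ := h
  exact ⟨t.1, fun w g => congrArg Prod.fst (ht w g)⟩

theorem tail {ρ : Ty} {l : List Ty} {F : World T → CtxVal Γ → DTup (ρ :: l)} (h : TupDef F) :
    TupDef (fun w g => (F w g).2) := by
  obtain ⟨t, ht⟩ := h
  exact ⟨t.2, fun w g => congrArg Prod.snd (ht w g)⟩

/-- Transfer of closure properties from functionals to tuples. -/
theorem lift {Γ' : List Ty} {W : Type*} (f : W → World T → CtxVal Γ → World T × CtxVal Γ')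
    (k : ∀ {τ : Ty} (F : World T → CtxVal Γ' → τ.den), TDef F →
      ∀ i, TDef (fun w g => F (f i w g).1 (f i w g).2)) (i : W) :
    ∀ {l : List Ty} {F : World T → CtxVal Γ' → DTup l}, TupDef F →
      TupDef (fun w g => F (f i w g).1 (f i w g).2)
  | [], _, _ => nil
  | _ :: _, _, h => cons (k _ h.head i) (lift f k i h.tail)

theorem ren {l : List Ty} {F : World T → CtxVal Γ → DTup l} (h : TupDef F)
    (r : ∀ ρ, Var Γ ρ → Var Δ ρ) : TupDef (fun (w : World T) g => F w (g.pull r)) := by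
  obtain ⟨t, ht⟩ := h
  exact ⟨t.ren r, fun w g => (Tup.val_ren _ _ r g t).trans (ht w _)⟩

theorem upd {l : List Ty} {F : World T → CtxVal Γ → DTup l} {s : World T → CtxVal Γ → ℕ} (z : ℕ)
    (hF : TupDef F) (hs : TDef (τ := .o) s) : TupDef (fun w g => F (w.upd z (s w g)) g) :=
  lift (fun (_ : Unit) w g => (w.upd z (s w g), g)) (fun _ h _ => h.upd z hs) () hF

theorem left {l m : List Ty} {F : World T → CtxVal Γ → DTup (l ++ m)} (h : TupDef F) :
    TupDef (fun w g => (F w g).left l) := by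
  obtain ⟨t, ht⟩ := h
  exact ⟨Tup.left l t, fun w g => (Tup.val_left _ _ _ l t).trans (congrArg _ (ht w g))⟩

theorem right {l m : List Ty} {F : World T → CtxVal Γ → DTup (l ++ m)} (h : TupDef F) :
    TupDef (fun w g => (F w g).right l) := by
  obtain ⟨t, ht⟩ := h
  exact ⟨Tup.right l t, fun w g => (Tup.val_right _ _ _ l t).trans (congrArg _ (ht w g))⟩

theorem append : ∀ {l m : List Ty} {F : World T → CtxVal Γ → DTup l}
    {G : World T → CtxVal Γ → DTup m}, TupDef F → TupDef G →
      TupDef (fun w g => (F w g).append (G w g))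
  | [], _, _, _, _, hG => hG
  | _ :: _, _, _, _, hF, hG => cons hF.head (append hF.tail hG)

theorem ap {l m : List Ty} {F : World T → CtxVal Γ → DTup (Ty.arrowT l m)}
    {G : World T → CtxVal Γ → DTup l} (hF : TupDef F) (hG : TupDef G) :
    TupDef (fun w g => DTup.ap (F w g) (G w g)) := by
  obtain ⟨t, ht⟩ := hF
  obtain ⟨s, hs⟩ := hG
  exact ⟨Tup.ap t s, fun w g => by rw [Tup.val_ap, ht, hs]⟩

theorem abs {l : List Ty} : ∀ {m : List Ty} {F : World T → CtxVal (l ++ Γ) → DTup m}, TupDef F →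
    TupDef (fun (w : World T) (g : CtxVal Γ) => DTup.abs fun d : DTup l => F w (g.ext d))
  | [], _, _ => nil
  | _ :: _, _, h => cons h.head.curry (abs h.tail)

theorem seq : ∀ {m : List Ty} {F : World T → CtxVal Γ → ℕ → DTup m},
    (∀ n, TupDef (fun w g => F w g n)) →
      TupDef (fun w g => DTup.abs (l := [.o]) fun d => F w g d.1)
  | [], _, _ => nil
  | _ :: _, _, h => cons (TDef.seq fun n => (h n).head) (seq fun n => (h n).tail)

end TupDef

/-- The values of the variables of a context, as a tuple. -/
def CtxVal.tup : {l : List Ty} → CtxVal l → DTup l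
  | [], _ => ()
  | _ :: _, g => (g _ .zero, CtxVal.tup (g.pull fun _ x => x.succ))

theorem TupDef.tup : ∀ {l : List Ty}, TupDef (fun (_ : World T) (g : CtxVal l) => g.tup)
  | [] => nil
  | _ :: _ => cons (.bvar .zero) (TupDef.tup.ren _)

/-- The embedding of a context in an extended context. -/
def embVar {Γ : List Ty} : {l : List Ty} → ∀ ρ, Var l ρ → Var (l ++ Γ) ρ
  | _, _, .zero => .zero
  | _, _, .succ x => .succ (embVar _ x)

theorem CtxVal.tup_ext {Γ : List Ty} (g : CtxVal Γ) : ∀ {l : List Ty} (d : DTup l),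
    CtxVal.tup ((g.ext d).pull embVar) = d
  | [], _ => rfl
  | _ :: _, d => Prod.ext rfl (g.tup_ext d.2)

/-- A beta-expansion: abstracting over the whole context and applying the result to `s` avoids
substitution for bound variables. -/
theorem TupDef.subst {Γ l m : List Ty} {F : World T → DTup l → DTup m}
    {s : World T → CtxVal Γ → DTup l} (hF : TupDef (fun w (g : CtxVal l) => F w g.tup))
    (hs : TupDef s) : TupDef (fun w g => F w (s w g)) := by
  have := (hF.ren (Δ := l ++ Γ) embVar).abs.ap hs
  simpa only [CtxVal.tup_ext, DTup.ap_abs] using this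

/-! ### Coded types, definable functions and decidable relations -/

/-- Types whose elements are represented by tuples of functionals. -/
class TupRep (A : Type) where
  l : List Ty
  enc : A → DTup l
  dec : DTup l → A
  dec_enc : ∀ a, dec (enc a) = a
  enc_dec : ∀ d, enc (dec d) = d

open TupRep

instance TupRep.nat : TupRep ℕ := ⟨[.o], fun n => (n, ()), fun d => d.1, fun _ => rfl, fun _ => rfl⟩

instance TupRep.unit : TupRep Unit := ⟨[], id, id, fun _ => rfl, fun _ => rfl⟩

instance TupRep.prod {A B : Type} [TupRep A] [TupRep B] : TupRep (A × B) where
  l := l A ++ l B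
  enc p := (enc p.1).append (enc p.2)
  dec d := (dec (d.left _), dec (d.right _))
  dec_enc p := by simp only [DTup.left_append, DTup.right_append, dec_enc]
  enc_dec d := by simp only [enc_dec, DTup.append_left_right]

/-- Because the type structure is the full set-theoretic one, every function between coded types has
a code, and by extensionality each tuple is the code of exactly one function. -/
instance TupRep.fun {A B : Type} [TupRep A] [TupRep B] : TupRep (A → B) where
  l := Ty.arrowT (l A) (l B)
  enc f := DTup.abs fun d => enc (f (dec d))
  dec d a := dec (d.ap (enc a))
  dec_enc f := by simp only [DTup.ap_abs, dec_enc]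
  enc_dec d := by simp only [enc_dec, DTup.abs_ap]

/-- Tuples represent themselves. -/
@[reducible] def TupRep.tup (l : List Ty) : TupRep (DTup l) := ⟨l, id, id, fun _ => rfl, fun _ => rfl⟩

/-- Functions given by terms, uniformly in the model and the valuation. -/
def Def {A B : Type} [TupRep A] [TupRep B] (F : World T → A → B) : Prop :=
  TupDef (fun (w : World T) (g : CtxVal (l A)) => enc (F w (dec g.tup)))

/-- Decidable relations. -/
def Dec {A : Type} [TupRep A] (P : World T → A → Prop) : Prop :=
  open Classical in Def (fun w a => if P w a then 0 else 1)

namespace Def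

variable {A B C : Type} [TupRep A] [TupRep B] [TupRep C]

theorem id : Def (fun (_ : World T) (a : A) => a) := by
  simp only [Def, enc_dec]; exact TupDef.tup

theorem comp {G : World T → B → C} {F : World T → A → B} (hG : Def G) (hF : Def F) :
    Def (fun w a => G w (F w a)) := by
  have := TupDef.subst (F := fun w d => enc (G w (dec d))) hG hF
  simp only [dec_enc] at this
  exact this

theorem pair {F : World T → A → B} {G : World T → A → C} (hF : Def F) (hG : Def G) :
    Def (fun w a => (F w a, G w a)) := TupDef.append hF hG

theorem fst {F : World T → A → B × C} (hF : Def F) : Def (fun w a => (F w a).1) := by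
  have := TupDef.left hF
  simp only [enc, DTup.left_append] at this
  exact this

theorem snd {F : World T → A → B × C} (hF : Def F) : Def (fun w a => (F w a).2) := by
  have := TupDef.right hF
  simp only [enc, DTup.right_append] at this
  exact this

theorem curry {F : World T → A → B → C} (hF : Def (fun w (p : A × B) => F w p.1 p.2)) :
    Def (fun w a => fun b => F w a b) := by
  have := TupDef.abs (l := l B) (Γ := l A) (TupDef.subst
    (F := fun w d => enc (F w (dec (d.left (l A))) (dec (d.right (l A))))) hF
    (TupDef.append (TupDef.tup.ren (weak (l B))) (TupDef.tup.ren embVar)))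
  simp only [DTup.left_append, DTup.right_append, CtxVal.ext_weak, CtxVal.tup_ext] at this
  exact this

theorem app {F : World T → A → B → C} {G : World T → A → B} (hF : Def F) (hG : Def G) :
    Def (fun w a => F w a (G w a)) := by
  have := TupDef.ap hF hG
  simp only [enc, DTup.ap_abs, dec_enc] at this
  exact this

/-- The main tool for recursion: definability for each fixed `n` suffices, and can be proved by
induction on `n` outside the terms. -/
theorem seq {F : World T → A → ℕ → C} (h : ∀ n, Def (fun w a => F w a n)) : Def F :=
  TupDef.seq h

theorem nat_iff {F : World T → A → ℕ} :
    Def F ↔ TDef (τ := .o) (fun w (g : CtxVal (l A)) => F w (dec g.tup)) :=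
  ⟨fun h => h.head, fun h => TupDef.cons h .nil⟩

theorem upd {F : World T → A → B} {s : World T → A → ℕ} (z : ℕ) (hF : Def F) (hs : Def s) :
    Def (fun w a => F (w.upd z (s w a)) a) := TupDef.upd z hF (nat_iff.1 hs)

theorem const (n : ℕ) : Def (fun (_ : World T) (_ : A) => n) := nat_iff.2 (.num n)

/-- No computability of `f` is involved: its table of numerals is itself an infinite term. -/
theorem natFun (f : ℕ → ℕ) {F : World T → A → ℕ} (hF : Def F) : Def (fun w a => f (F w a)) :=
  app (F := fun _ _ => f) (seq fun n => const (f n)) hF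

theorem nat₂ (f : ℕ → ℕ → ℕ) {F G : World T → A → ℕ} (hF : Def F) (hG : Def G) :
    Def (fun w a => f (F w a) (G w a)) :=
  app (F := fun w a => f (F w a)) (app (F := fun _ _ => f)
    (seq fun n => seq fun m => const (f n m)) hF) hG

open Classical in
theorem ite {P : World T → A → Prop} {F G : World T → A → B} (hP : Dec P) (hF : Def F)
    (hG : Def G) : Def (fun w a => if P w a then F w a else G w a) := by
  -- The infinite term with entry `F` at `0` and `G` elsewhere, to be applied to the characteristic
  -- function of `P`, for which `0` means true.
  have : Def (fun w a => fun n : ℕ => if n = 0 then F w a else G w a) := by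
    refine seq fun n => ?_
    by_cases h : n = 0
    · simpa only [h, if_true] using hF
    · simpa only [h, if_false] using hG
  have := this.app hP
  convert this using 4
  split <;> simp_all

theorem realize (t : FTerm L) : Def (fun (w : World T) (_ : A) => letI := w.M; t.realize w.v) :=
  nat_iff.2 ⟨iota (fun y => .fvar .o y) t, fun w g => val_iota w.std w.e g _ t⟩

theorem congr {F G : World T → A → B} (h : Def F) (e : ∀ w a, F w a = G w a) : Def G := by
  have : F = G := funext fun w => funext fun a => e w a
  exact this ▸ h

end Def

namespace Dec

variable {A B : Type} [TupRep A] [TupRep B]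

theorem congr {P Q : World T → A → Prop} (h : Dec P) (e : ∀ w a, P w a ↔ Q w a) : Dec Q := by
  have : P = Q := funext fun w => funext fun a => propext (e w a)
  exact this ▸ h

theorem comp {P : World T → B → Prop} {F : World T → A → B} (hP : Dec P) (hF : Def F) :
    Dec (fun w a => P w (F w a)) := Def.comp hP hF

theorem upd {P : World T → A → Prop} {s : World T → A → ℕ} (z : ℕ) (hP : Dec P) (hs : Def s) :
    Dec (fun w a => P (w.upd z (s w a)) a) := Def.upd z hP hs

theorem nat (p : ℕ → Prop) {F : World T → A → ℕ} (hF : Def F) : Dec (fun w a => p (F w a)) := by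
  classical
  exact (Def.natFun (fun n => if p n then 0 else 1) hF).congr fun w a => by congr

theorem nat₂ (p : ℕ → ℕ → Prop) {F G : World T → A → ℕ} (hF : Def F) (hG : Def G) :
    Dec (fun w a => p (F w a) (G w a)) := by
  classical
  exact (Def.nat₂ (fun m n => if p m n then 0 else 1) hF hG).congr fun w a => by congr

theorem not {P : World T → A → Prop} (hP : Dec P) : Dec (fun w a => ¬ P w a) :=
  (nat (· ≠ 0) hP).congr fun w a => by simp

theorem or {P Q : World T → A → Prop} (hP : Dec P) (hQ : Dec Q) :
    Dec (fun w a => P w a ∨ Q w a) :=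
  (nat₂ (fun m n => m = 0 ∨ n = 0) hP hQ).congr fun w a => by simp

theorem seq {P : World T → A → ℕ → Prop} (hP : ∀ n, Dec (fun w a => P w a n))
    {s : World T → A → ℕ} (hs : Def s) : Dec (fun w a => P w a (s w a)) := by
  classical
  exact Def.app (F := fun w a n => if P w a n then 0 else 1) (Def.seq hP) hs

end Dec

/-! ### Bounded search, zero functionals and decidability of atomic formulas -/

open Classical in
/-- The greatest number below a bound with a given property, and `0` if there is none. -/
noncomputable def search (P : ℕ → Prop) : ℕ → ℕ
  | 0 => 0
  | n + 1 => if P n then n else search P n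

theorem search_spec {P : ℕ → Prop} {n k : ℕ} (hk : k < n) (h : P k) : P (search P n) := by
  induction n with
  | zero => omega
  | succ n ih =>
    rw [search]
    split
    · assumption
    · rename_i hn
      refine ih (lt_of_le_of_ne (Nat.le_of_lt_succ hk) ?_)
      rintro rfl
      exact hn h

/-- For a fixed bound the search is a finite nest of case distinctions; the sequence of these is
then applied to the actual bound. -/
theorem Def.search {A : Type} [TupRep A] {P : World T → A → ℕ → Prop}
    (hP : ∀ n, Dec (fun w a => P w a n)) {s : World T → A → ℕ} (hs : Def s) :
    Def (fun w a => ShInt.search (P w a) (s w a)) := by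
  refine Def.app (F := fun w a => ShInt.search (P w a)) (Def.seq fun n => ?_) hs
  induction n with
  | zero => exact Def.const 0
  | succ n ih => exact Def.ite (hP n) (Def.const n) ih

/-- Counterexamples can only lie below the bound, so the universal statement is equivalent to its
instance at the outcome of the search for one. The default outcome `0` does no harm, being an
instance as well. -/
theorem Dec.forall_of_bound {A : Type} [TupRep A] {P : World T → A → ℕ → Prop}
    (hP : ∀ n, Dec (fun w a => P w a n)) {s : World T → A → ℕ} (hs : Def s)
    (h : ∀ w a n, s w a ≤ n → P w a n) : Dec (fun w a => ∀ n, P w a n) := by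
  refine (Dec.seq hP (Def.search (fun n => (hP n).not) hs)).congr fun w a => ⟨fun h' n => ?_, fun h' => h' _⟩
  by_contra hn
  exact search_spec (P := fun n => ¬ P w a n)
    (lt_of_not_ge fun hle => hn (h w a n hle)) hn h'

/-- The functional that is constantly zero. -/
def Ty.zero : (ρ : Ty) → ρ.den
  | .o => (0 : ℕ)
  | .arrow _ τ => fun _ => τ.zero

/-- A closed term for the functional that is constantly zero. -/
def Tm.zeroAt : {Γ : List Ty} → (ρ : Ty) → Tm L Γ ρ
  | _, .o => .zero
  | _, .arrow _ τ => .lam (Tm.zeroAt τ)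

theorem Tm.FV_zeroAt : ∀ (ρ : Ty) {Γ : List Ty}, (Tm.zeroAt ρ : Tm L Γ ρ).FV = ∅
  | .o, _ => rfl
  | .arrow _ τ, _ => Tm.FV_zeroAt τ

theorem TDef.zero : ∀ {ρ : Ty} {Γ : List Ty}, TDef (fun (_ : World T) (_ : CtxVal Γ) => ρ.zero)
  | .o, _ => .num 0
  | .arrow _ _, _ => TDef.zero.lam

/-- The tuple of zero functionals. -/
def DTup.zero : (l : List Ty) → DTup l
  | [] => ()
  | ρ :: l => (ρ.zero, DTup.zero l)

theorem TupDef.zero {Γ : List Ty} : ∀ {l : List Ty},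
    TupDef (fun (_ : World T) (_ : CtxVal Γ) => DTup.zero l)
  | [] => nil
  | _ :: _ => cons TDef.zero TupDef.zero

/-- The element represented by zero functionals. -/
def TupRep.zero (A : Type) [TupRep A] : A := dec (DTup.zero (l A))

theorem Def.zero {A B : Type} [TupRep A] [TupRep B] :
    Def (fun (_ : World T) (_ : A) => TupRep.zero B) := by
  simp only [Def, TupRep.zero, enc_dec]
  exact TupDef.zero

theorem Def.enc {A B : Type} [TupRep A] [TupRep B] {F : World T → A → B} (hF : Def F) :
    letI := TupRep.tup (l B); Def (fun w a => enc (F w a)) := hF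

theorem Def.dec {A B : Type} [TupRep A] [TupRep B] {F : World T → A → DTup (l B)}
    (hF : letI := TupRep.tup (l B); Def F) : Def (fun w a => (dec (F w a) : B)) := by
  simp only [Def, enc_dec]
  exact hF

theorem updList_map (e f : ℕ → ℕ) {x : List ℕ} {y : ℕ} (h : y ∈ x) :
    updList e x (fun j => f (x.get j)) y = f y := by
  simp [updList, h]

/-- Truth of a quantifier-free formula with a non-arithmetical symbol is decidable. -/
theorem Dec.holds_of_not_isAr {A : Type} [TupRep A] {φ : Fml L} (hq : φ.QF) (hn : ¬ φ.IsAr)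
    {s : ℕ → World T → A → ℕ} (hs : ∀ i, Def (s i)) :
    Dec (fun w a => φ.Holds w.M fun i => s i w a) := by
  classical
  choose t ht using fun i => Def.nat_iff.1 (hs i)
  refine Def.nat_iff.2 ⟨Tm.appN (.cas φ hq hn) (Fin.append (fun j => t (φ.fvs.get j))
    ![.num 0, .num 1]), fun w g => ?_⟩
  rw [Tm.val_appN w.M w.e g _ _ _ rfl]
  simp only [Fin.append_left, Fin.append_right, ht]
  have key : φ.Holds w.M (updList w.v φ.fvs fun j => s (φ.fvs.get j) w (TupRep.dec g.tup)) ↔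
      φ.Holds w.M fun i => s i w (TupRep.dec g.tup) :=
    φ.holds_congr w.M fun x hx =>
      updList_map w.v (fun i => s i w (TupRep.dec g.tup)) (by simpa [Fml.fvs] using hx)
  by_cases h : φ.Holds w.M fun i => s i w (TupRep.dec g.tup)
  · rw [if_pos (key.2 h), if_pos h]
    exact Tm.val_num w.std _ _ 0
  · rw [if_neg (fun h' => h (key.1 h')), if_neg h]
    exact Tm.val_num w.std _ _ 1

/-- The relation `<` has a table of numerals because arithmetic is standard; any other symbol has
the case distinction constant of its atomic formula in the variables `0, …, k - 1`. -/
theorem Dec.rel {A : Type} [TupRep A] {k : ℕ} (R : (sig L).Relations k)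
    {s : Fin k → World T → A → ℕ} (hs : ∀ i, Def (s i)) :
    Dec (fun w a => w.M.RelMap R (fun i => s i w a)) := by
  rcases R with R | R
  · cases R
    refine (Dec.nat₂ (· < ·) (hs 0) (hs 1)).congr fun w a => ?_
    exact (w.std.relMap_lt fun i => s i w a).symm
  · refine (Dec.holds_of_not_isAr (φ := .rel (Sum.inr R) fun i : Fin k => .var i.val) trivial
      (fun h => Bool.false_ne_true h.1)
      (s := fun i w a => if h : i < k then s ⟨i, h⟩ w a else 0) fun i => ?_).congr fun w a => ?_
    · by_cases h : i < k
      · simpa only [h, dif_pos] using hs ⟨i, h⟩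
      · simpa only [h, dif_neg, not_false_eq_true] using Def.const 0
    · refine iff_of_eq (congrArg (w.M.RelMap (Sum.inr R : (sig L).Relations k))
        (funext fun i => ?_))
      exact dif_pos i.isLt

/-! ### Problems -/

/-- A relation between tuples of functionals `u` and `x`, uniformly in a model and a valuation, to
be read as `∀ u ∃ x`. -/
structure Prob (T : Set (Fml L)) where
  U : Type
  X : Type
  [repU : TupRep U]
  [repX : TupRep X]
  sh : World T → U → X → Prop

namespace Prob

attribute [instance] repU repX

variable (P Q R : Prob T)

-- A function `f` is a proposed solution of `P`, and the reply is a `u` at which it fails.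
@[reducible] def neg : Prob T := ⟨P.U → P.X, P.U, fun w f u => ¬ P.sh w u (f u)⟩

@[reducible] def or : Prob T :=
  ⟨P.U × Q.U, P.X × Q.X, fun w u x => P.sh w u.1 x.1 ∨ Q.sh w u.2 x.2⟩

@[reducible] def all (z : ℕ) : Prob T :=
  ⟨ℕ × P.U, P.X, fun w u x => P.sh (w.upd z u.1) u.2 x⟩

@[reducible] def imp : Prob T := or (neg P) Q

@[reducible] def and : Prob T := neg (or (neg P) (neg Q))

/-- The value of the variable `x` being replaced by `s`. -/
@[reducible] def upd (x : ℕ) (s : World T → ℕ) : Prob T :=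
  ⟨P.U, P.X, fun w => P.sh (w.upd x (s w))⟩

/-- Problems with a decidable relation. -/
def IsDec : Prop := Dec (fun w (p : P.U × P.X) => P.sh w p.1 p.2)

/-- Problems with a solution given by terms. -/
def Realized : Prop := ∃ F : World T → P.U → P.X, Def F ∧ ∀ w u, P.sh w u (F w u)

variable {P Q R}

theorem IsDec.dec {A : Type} [TupRep A] (hP : P.IsDec) {F : World T → A → P.U}
    {G : World T → A → P.X} (hF : Def F) (hG : Def G) :
    Dec (fun w a => P.sh w (F w a) (G w a)) := Dec.comp hP (hF.pair hG)

theorem IsDec.neg (hP : P.IsDec) : P.neg.IsDec :=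
  (hP.dec Def.id.snd (Def.id.fst.app Def.id.snd)).not

theorem IsDec.or (hP : P.IsDec) (hQ : Q.IsDec) : (P.or Q).IsDec :=
  (hP.dec Def.id.fst.fst Def.id.snd.fst).or (hQ.dec Def.id.fst.snd Def.id.snd.snd)

theorem IsDec.all (hP : P.IsDec) (z : ℕ) : (P.all z).IsDec :=
  Dec.upd (P := fun w (p : (ℕ × P.U) × P.X) => P.sh w p.1.2 p.2) z
    (hP.dec Def.id.fst.snd Def.id.snd) Def.id.fst.fst

/-! ### Logical rules -/

theorem realized_em (P : Prob T) : (P.neg.or P).Realized :=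
  ⟨fun _ p => (p.2, p.1 p.2), Def.id.snd.pair (Def.id.fst.app Def.id.snd),
    fun w p => (em (P.sh w p.2 (p.1 p.2))).symm⟩

theorem Realized.expand (h : P.Realized) (Q : Prob T) : (P.or Q).Realized := by
  obtain ⟨F, hF, h⟩ := h
  exact ⟨fun w p => (F w p.1, TupRep.zero _), (hF.comp Def.id.fst).pair Def.zero,
    fun w p => Or.inl (h w p.1)⟩

/-- A solution for both copies of `u` yields two candidate replies, at least one of which is
correct; decidability of `P` lets a term pick it. -/
theorem Realized.contr (hP : P.IsDec) (h : (P.or P).Realized) : P.Realized := by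
  classical
  obtain ⟨F, hF, h⟩ := h
  have hF' : Def (fun w u => F w (u, u)) := hF.comp (Def.id.pair Def.id)
  refine ⟨fun w u => if P.sh w u (F w (u, u)).1 then (F w (u, u)).1 else (F w (u, u)).2,
    Def.ite (hP.dec Def.id hF'.fst) hF'.fst hF'.snd, fun w u => ?_⟩
  dsimp only
  split
  · assumption
  · exact (h w (u, u)).resolve_left ‹_›

theorem Realized.assoc (h : ((P.or Q).or R).Realized) : (P.or (Q.or R)).Realized := by
  obtain ⟨F, hF, h⟩ := h
  have hF' : Def (fun w (p : P.U × (Q.U × R.U)) => F w ((p.1, p.2.1), p.2.2)) :=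
    hF.comp ((Def.id.fst.pair Def.id.snd.fst).pair Def.id.snd.snd)
  exact ⟨fun w p => ((F w ((p.1, p.2.1), p.2.2)).1.1,
    ((F w ((p.1, p.2.1), p.2.2)).1.2, (F w ((p.1, p.2.1), p.2.2)).2)),
    hF'.fst.fst.pair (hF'.fst.snd.pair hF'.snd), fun w p => or_assoc.1 (h w ((p.1, p.2.1), p.2.2))⟩

/-- With the `Q`-challenge fixed, `F` proposes a solution `f` of `P`. The solution `G` either
answers `R` or names a `u` at which `f` fails; at that `u`, `F` must have answered `Q`. -/
theorem Realized.cut (h : (P.or Q).Realized) (h' : (P.neg.or R).Realized) :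
    (Q.or R).Realized := by
  obtain ⟨F, hF, h⟩ := h
  obtain ⟨G, hG, h'⟩ := h'
  let f : World T → Q.U → P.U → P.X := fun w v u => (F w (u, v)).1
  have hf : Def f := Def.curry (hF.comp (Def.id.snd.pair Def.id.fst)).fst
  have hG' : Def (fun w (p : Q.U × R.U) => G w (f w p.1, p.2)) :=
    hG.comp ((hf.comp Def.id.fst).pair Def.id.snd)
  refine ⟨fun w p => ((F w ((G w (f w p.1, p.2)).1, p.1)).2, (G w (f w p.1, p.2)).2),
    (hF.comp (hG'.fst.pair Def.id.fst)).snd.pair hG'.snd, fun w p => ?_⟩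
  rcases h' w (f w p.1, p.2) with h₁ | h₁
  · exact Or.inl ((h w (_, p.1)).resolve_left h₁)
  · exact Or.inr h₁

theorem Realized.all (h : P.Realized) (z : ℕ) : (P.all z).Realized := by
  obtain ⟨F, hF, h⟩ := h
  exact ⟨fun w p => F (w.upd z p.1) p.2, Def.upd z (hF.comp Def.id.snd) (s := fun _ p => p.1)
    Def.id.fst, fun w p => h _ _⟩

/-- Solutions are uniform in the valuation, so the given one may be used at the world in which `z`
has the challenged value; the variable condition carries `Q` back to the original world. -/
theorem Realized.gen {z : ℕ} (h : (P.or Q).Realized)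
    (hQ : ∀ w a u x, Q.sh (w.upd z a) u x ↔ Q.sh w u x) : ((P.all z).or Q).Realized := by
  obtain ⟨F, hF, h⟩ := h
  exact ⟨fun w p => F (w.upd z p.1.1) (p.1.2, p.2),
    Def.upd z (hF.comp (Def.id.fst.snd.pair Def.id.snd)) (s := fun _ p => p.1.1) Def.id.fst.fst,
    fun w p => (h (w.upd z p.1.1) (p.1.2, p.2)).imp_right (hQ _ _ _ _).1⟩

theorem realized_inst (P : Prob T) (x : ℕ) {s : World T → ℕ}
    (hs : Def (fun w (_ : (ℕ × P.U → P.X) × P.U) => s w)) :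
    ((P.all x).imp (P.upd x s)).Realized :=
  ⟨fun w p => ((s w, p.2), p.1 (s w, p.2)), (hs.pair Def.id.snd).pair
    (Def.id.fst.app (hs.pair Def.id.snd)), fun w p => (em (P.sh (w.upd x (s w)) p.2 _)).symm⟩

/-! ### Induction -/

section Induction

variable {U X : Type}

/-- Iteration of solutions of the induction step, from a solution of the base case. -/
def indSol (g : U → X) (j : ℕ × (U → X) × U → U × X) : ℕ → U → X
  | 0 => g
  | n + 1 => fun u => (j (n, indSol g j n, u)).2

open Classical in
/-- The refutation of the base case or of an induction step, from a refutation of the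
conclusion. -/
noncomputable def indRef [TupRep U] [TupRep X] (S : ℕ → U → X → Prop) (g : U → X)
    (j : ℕ × (U → X) × U → U × X) : ℕ → U → U × (ℕ × (U → X) × U)
  | 0, u => (u, TupRep.zero _)
  | n + 1, u =>
      if ¬ S n (j (n, indSol g j n, u)).1 (indSol g j n (j (n, indSol g j n, u)).1) ∨
        S (n + 1) u (j (n, indSol g j n, u)).2
      then indRef S g j n (j (n, indSol g j n, u)).1
      else (TupRep.zero _, (n, indSol g j n, u))

/-- Suppose the iterated solution fails at `n + 1` and `u`. Either the step from `n` fails on the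
data used there, and is refuted, or the `u'` that it returned is a failure of the iterated solution
at `n`. The descent ends at the base case. Since `u` changes on the way, the induction is for all
`u`. -/
theorem indRef_spec [TupRep U] [TupRep X] (S : ℕ → U → X → Prop) (g : U → X)
    (j : ℕ × (U → X) × U → U × X) (n : ℕ) (u : U) :
    (¬ S 0 (indRef S g j n u).1 (g (indRef S g j n u).1) ∨
      ¬ (¬ S (indRef S g j n u).2.1 (j (indRef S g j n u).2).1
          ((indRef S g j n u).2.2.1 (j (indRef S g j n u).2).1) ∨
        S ((indRef S g j n u).2.1 + 1) (indRef S g j n u).2.2.2 (j (indRef S g j n u).2).2)) ∨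
    S n u (indSol g j n u) := by
  induction n generalizing u with
  | zero => exact (em _).symm.imp_left Or.inl
  | succ n ih =>
    by_cases h : ¬ S n (j (n, indSol g j n, u)).1 (indSol g j n (j (n, indSol g j n, u)).1) ∨
        S (n + 1) u (j (n, indSol g j n, u)).2
    · rw [indRef, if_pos h]
      -- If the iterated solution is correct at `n` for the returned challenge, the correct step
      -- leaves only success at `n + 1`.
      exact (ih _).imp_right fun h' => h.resolve_left (not_not_intro h')
    · rw [indRef, if_neg h]
      exact Or.inl (Or.inr h)

/-- A statement for each fixed `n`; `Def.seq` later makes `n` an argument. -/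
theorem def_indSol [TupRep U] [TupRep X] (n : ℕ) :
    Def (fun (_ : World T) (p : (U → X) × (ℕ × (U → X) × U → U × X)) => indSol p.1 p.2 n) := by
  induction n with
  | zero => exact Def.id.fst
  | succ n ih =>
    refine Def.curry ?_
    exact (Def.id.fst.snd.app
      ((Def.const n).pair ((ih.comp Def.id.fst).pair Def.id.snd))).snd

theorem def_indRef (hP : P.IsDec) (x : ℕ) (n : ℕ) :
    Def (fun (w : World T) (p : ((P.U → P.X) × (ℕ × (P.U → P.X) × P.U → P.U × P.X)) × P.U) =>
      indRef (fun k => P.sh (w.upd x k)) p.1.1 p.1.2 n p.2) := by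
  induction n with
  | zero => exact Def.id.snd.pair Def.zero
  | succ n ih =>
    have hr := (def_indSol (T := T) (U := P.U) (X := P.X) n).comp
      (Def.id (A := ((P.U → P.X) × (ℕ × (P.U → P.X) × P.U → P.U × P.X)) × P.U)).fst
    have hi := (Def.const (T := T) n).pair (hr.pair Def.id.snd)
    have hj := Def.id.fst.snd.app hi
    refine (Def.ite (((Dec.upd x hP (Def.const n)).comp (hj.fst.pair (hr.app hj.fst))).not.or
      ((Dec.upd x hP (Def.const (n + 1))).comp (Def.id.snd.pair hj.snd)))
      (ih.comp (Def.id.fst.pair hj.fst)) (Def.zero.pair hi)).congr fun w p => ?_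
    rw [indRef]
    congr

end Induction

theorem realized_ind (hP : P.IsDec) (x : ℕ) :
    (((P.upd x fun _ => 0).and ((P.imp (P.upd x fun w => w.v x + 1)).all x)).imp
      (P.all x)).Realized := by
  let G := P.U → P.X
  let D := G × (ℕ × G × P.U → P.U × P.X)
  let A := ((D → P.U × (ℕ × G × P.U)) → D) × (ℕ × P.U)
  -- In a challenge `p`, the component `p.2` is the number and the `u` of the conclusion, while
  -- `p.1` yields solutions `d` of base and step only in exchange for a method of refuting any such
  -- `d`. Descent from `p.2` is that method; the pair `p.1 (H w p)` is then iterated to answer the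
  -- conclusion.
  let H : World T → A → D → P.U × (ℕ × G × P.U) := fun w p d =>
    indRef (fun k => P.sh (w.upd x k)) d.1 d.2 p.2.1 p.2.2
  have hH : Def H := by
    refine Def.curry ?_
    exact Def.app (F := fun (w : World T) (q : A × D) (n : ℕ) =>
      indRef (fun k => P.sh (w.upd x k)) q.2.1 q.2.2 n q.1.2.2)
      (Def.seq fun n => (def_indRef hP x n).comp (Def.id.snd.pair Def.id.fst.snd.snd))
      Def.id.fst.snd.fst
  have hK : Def (fun w (p : A) => p.1 (H w p)) := Def.id.fst.app hH
  have hr : Def (fun w (p : A) =>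
      indSol (p.1 (H w p)).1 (p.1 (H w p)).2 p.2.1 p.2.2) :=
    Def.app (Def.app (F := fun w (p : A) n => indSol (p.1 (H w p)).1 (p.1 (H w p)).2 n)
      (Def.seq fun n => (def_indSol n).comp hK) Def.id.snd.fst) Def.id.snd.snd
  refine ⟨fun w p => (H w p, indSol (p.1 (H w p)).1 (p.1 (H w p)).2 p.2.1 p.2.2),
    hH.pair hr, fun w p => ?_⟩
  refine (indRef_spec (fun k => P.sh (w.upd x k)) (p.1 (H w p)).1 (p.1 (H w p)).2 p.2.1
    p.2.2).imp_left fun h => not_not_intro (h.imp_right fun h => ?_)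
  -- The term `S x` is evaluated after `x` has received the value `k`, so the two successive updates
  -- amount to one with value `k + 1`.
  simpa only [World.upd_upd, World.v_upd, Function.update_self] using h

/-! ### Simulations -/

/-- A uniform reduction of solutions of `Q` to solutions of `P`. -/
def Sim (P Q : Prob T) : Prop :=
  ∃ (a : World T → Q.U → P.U) (b : World T → Q.U × P.X → Q.X), Def a ∧ Def b ∧
    ∀ w u x, P.sh w (a w u) x → Q.sh w u (b w (u, x))

theorem Realized.sim (h : P.Realized) (s : Sim P Q) : Q.Realized := by
  obtain ⟨F, hF, h⟩ := h
  obtain ⟨a, b, ha, hb, s⟩ := s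
  exact ⟨fun w u => b w (u, F w (a w u)), hb.comp (Def.id.pair (hF.comp ha)),
    fun w u => s w u _ (h w _)⟩

theorem Sim.trans (s : Sim P Q) (s' : Sim Q R) : Sim P R := by
  obtain ⟨a, b, ha, hb, s⟩ := s
  obtain ⟨a', b', ha', hb', s'⟩ := s'
  exact ⟨fun w u => a w (a' w u), fun w p => b' w (p.1, b w (a' w p.1, p.2)), ha.comp ha',
    hb'.comp (Def.id.fst.pair (hb.comp ((ha'.comp Def.id.fst).pair Def.id.snd))),
    fun w u x h => s' w u _ (s w _ x h)⟩

theorem Sim.neg (s : Sim Q P) : Sim P.neg Q.neg := by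
  obtain ⟨a, b, ha, hb, s⟩ := s
  refine ⟨fun w f u => b w (u, f (a w u)), fun w p => a w p.2, ?_, ha.comp Def.id.snd,
    fun w f u h h' => h (s w u _ h')⟩
  refine Def.curry ?_
  exact hb.comp (Def.id.snd.pair (Def.id.fst.app (ha.comp Def.id.snd)))

theorem Sim.or {P' Q' : Prob T} (s : Sim P Q) (s' : Sim P' Q') : Sim (P.or P') (Q.or Q') := by
  obtain ⟨a, b, ha, hb, s⟩ := s
  obtain ⟨a', b', ha', hb', s'⟩ := s'
  exact ⟨fun w p => (a w p.1, a' w p.2), fun w p => (b w (p.1.1, p.2.1), b' w (p.1.2, p.2.2)),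
    (ha.comp Def.id.fst).pair (ha'.comp Def.id.snd),
    (hb.comp (Def.id.fst.fst.pair Def.id.snd.fst)).pair
      (hb'.comp (Def.id.fst.snd.pair Def.id.snd.snd)),
    fun w u x h => h.imp (s w _ _) (s' w _ _)⟩

theorem Sim.all (s : Sim P Q) (z : ℕ) : Sim (P.all z) (Q.all z) := by
  obtain ⟨a, b, ha, hb, s⟩ := s
  exact ⟨fun w p => (p.1, a (w.upd z p.1) p.2), fun w p => b (w.upd z p.1.1) (p.1.2, p.2),
    Def.id.fst.pair (Def.upd z (ha.comp Def.id.snd) (s := fun _ p => p.1) Def.id.fst),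
    Def.upd z (hb.comp (Def.id.fst.snd.pair Def.id.snd)) (s := fun _ p => p.1.1) Def.id.fst.fst,
    fun w u x h => s _ _ _ h⟩

/-- Mutual reductions. -/
def Equi (P Q : Prob T) : Prop := Sim P Q ∧ Sim Q P

theorem Equi.trans (h : Equi P Q) (h' : Equi Q R) : Equi P R :=
  ⟨h.1.trans h'.1, h'.2.trans h.2⟩

theorem Equi.neg (h : Equi P Q) : Equi P.neg Q.neg := ⟨h.2.neg, h.1.neg⟩

theorem Equi.or {P' Q' : Prob T} (h : Equi P Q) (h' : Equi P' Q') : Equi (P.or P') (Q.or Q') :=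
  ⟨h.1.or h'.1, h.2.or h'.2⟩

theorem Equi.all (h : Equi P Q) (z : ℕ) : Equi (P.all z) (Q.all z) := ⟨h.1.all z, h.2.all z⟩

/-- The same problem, with tuples in place of the elements that they represent. -/
@[reducible] def coded (P : Prob T) : Prob T :=
  { U := DTup (TupRep.l P.U)
    X := DTup (TupRep.l P.X)
    repU := TupRep.tup _
    repX := TupRep.tup _
    sh := fun w u x => P.sh w (TupRep.dec u) (TupRep.dec x) }

/-- Connects the literal type-tuples of the Shoenfield interpretation with the product and function
types formed by the operations on problems. -/
theorem equi_coded (P : Prob T) : Equi P.coded P := by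
  let := TupRep.tup (TupRep.l P.U)
  let := TupRep.tup (TupRep.l P.X)
  refine ⟨⟨fun _ u => TupRep.enc u, fun _ p => TupRep.dec p.2, Def.id.enc, Def.id.snd.dec, ?_⟩,
    ⟨fun _ u => TupRep.dec u, fun _ p => TupRep.enc p.2, Def.id.dec, Def.id.snd.enc, ?_⟩⟩
  · intro w u x h
    simpa only [TupRep.dec_enc] using h
  · intro w u x h
    simpa only [TupRep.dec_enc] using h

theorem IsDec.coded (hP : P.IsDec) : P.coded.IsDec := by
  let := TupRep.tup (TupRep.l P.U)
  let := TupRep.tup (TupRep.l P.X)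
  exact hP.dec Def.id.fst.dec Def.id.snd.dec

/-- Universal quantification, kept inside of the relation. -/
@[reducible] def ball (P : Prob T) (z : ℕ) : Prob T :=
  ⟨P.U, P.X, fun w u x => ∀ a, P.sh (w.upd z a) u x⟩

/-- An instance is obtained from the universal statement at once. Conversely, one searches below the
bound for a value of `z` falsifying the matrix and puts it forward as the challenge; if the matrix
holds even there, it holds everywhere. That `X` has one element is essential: otherwise a reply for
this `z` would say nothing about other values. -/
theorem equi_ball (hP : P.IsDec) (hX : Subsingleton P.X) (z : ℕ) {s : World T → ℕ}
    (hs : Def (fun w (_ : P.U) => s w)) (h : ∀ w a u x, s w ≤ a → P.sh (w.upd z a) u x) :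
    Equi (P.ball z) (P.all z) := by
  refine ⟨⟨fun _ p => p.2, fun _ p => p.2, Def.id.snd, Def.id.snd, fun w u x h => h _⟩,
    ⟨fun w u => (search (fun n => ¬ P.sh (w.upd z n) u (TupRep.zero _)) (s w), u), fun _ p => p.2,
      (Def.search (fun n => (Dec.upd z (hP.dec Def.id Def.zero) (Def.const n)).not) hs).pair
        Def.id, Def.id.snd, ?_⟩⟩
  intro w u x hx a
  by_contra hn
  refine search_spec (P := fun n => ¬ P.sh (w.upd z n) u (TupRep.zero _))
    (lt_of_not_ge fun hle => hn (h w a u x hle)) ?_ ?_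
  · rwa [Subsingleton.elim x (TupRep.zero _)] at hn
  · rwa [Subsingleton.elim x (TupRep.zero _)] at hx

theorem IsDec.ball (hP : P.IsDec) (z : ℕ) {s : World T → ℕ}
    (hs : Def (fun w (_ : P.U × P.X) => s w))
    (h : ∀ w a u x, s w ≤ a → P.sh (w.upd z a) u x) : (P.ball z).IsDec :=
  Dec.forall_of_bound (P := fun w (p : P.U × P.X) n => P.sh (w.upd z n) p.1 p.2)
    (fun n => Dec.upd z hP (Def.const n)) hs fun w p n => h w n p.1 p.2

end Prob

/-! ### The interpretation without the special treatment of bounded quantifiers -/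

theorem realize_tsubst (M : (sig L).Structure ℕ) (x : ℕ) (t s : FTerm L) (v : ℕ → ℕ) :
    (tsubst x t s).realize v = s.realize (Function.update v x (t.realize v)) := by
  rw [tsubst, FirstOrder.Language.Term.realize_subst]
  congr 1; funext y
  by_cases h : y = x
  · subst h; simp
  · simp [h]

theorem tsubst_of_notMem {x : ℕ} {t s : FTerm L} (h : x ∉ tvars s) : tsubst x t s = s := by
  induction s with
  | var y =>
    have : y ≠ x := fun e => h (by simp [tvars, e])
    simp [tsubst, this]
  | func f ts ih =>
    simp only [tsubst, FirstOrder.Language.Term.subst]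
    congr 1; funext i
    refine ih i fun hx => h ?_
    simp only [tvars, List.mem_flatten, List.mem_ofFn]
    exact ⟨_, ⟨i, rfl⟩, hx⟩

namespace Fml

theorem subst_of_notMem {x : ℕ} {t : FTerm L} {φ : Fml L} (h : x ∉ φ.fvl) : φ.subst x t = φ := by
  induction φ with
  | eq s r =>
    simp only [fvl, List.mem_append, not_or] at h
    rw [subst, tsubst_of_notMem h.1, tsubst_of_notMem h.2]
  | rel R ts =>
    rw [subst]
    congr 1; funext i
    exact tsubst_of_notMem fun hx => h (mem_FV_rel hx)
  | neg φ ih => rw [subst, ih h]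
  | or φ ψ ihφ ihψ =>
    simp only [fvl, List.mem_append, not_or] at h
    rw [subst, ihφ h.1, ihψ h.2]
  | all y φ ih =>
    rw [subst]
    split
    · rfl
    · rename_i hy
      rw [ih fun hx => h (by simpa [fvl, hx] using fun e : x = y => hy e.symm)]

/-- The Shoenfield interpretation, all quantifiers being treated as unbounded ones. -/
noncomputable def prob (T : Set (Fml L)) : Fml L → Prob T
  | eq t s => ⟨Unit, Unit, fun w _ _ => (eq t s).Holds w.M w.v⟩
  | rel R ts => ⟨Unit, Unit, fun w _ _ => (rel R ts).Holds w.M w.v⟩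
  | neg φ => (prob T φ).neg
  | or φ ψ => (prob T φ).or (prob T ψ)
  | all z φ => (prob T φ).all z

theorem dec_eq {A : Type} [TupRep A] (t s : FTerm L) :
    Dec (fun (w : World T) (_ : A) => (eq t s).Holds w.M w.v) :=
  Dec.nat₂ (· = ·) (.realize t) (.realize s)

theorem dec_rel {A : Type} [TupRep A] {k : ℕ} (R : (sig L).Relations k) (ts : Fin k → FTerm L) :
    Dec (fun (w : World T) (_ : A) => (rel R ts).Holds w.M w.v) :=
  Dec.rel R fun i => .realize (ts i)

theorem prob_isDec (φ : Fml L) : (φ.prob T).IsDec := by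
  induction φ with
  | eq t s => exact dec_eq t s
  | rel R ts => exact dec_rel R ts
  | neg φ ih => exact ih.neg
  | or φ ψ ihφ ihψ => exact ihφ.or ihψ
  | all z φ ih => exact ih.all z

theorem holds_upd_of_notMem {x : ℕ} {φ : Fml L} (h : x ∉ φ.fvl) (w : World T) (a : ℕ) :
    φ.Holds (w.upd x a).M (w.upd x a).v ↔ φ.Holds w.M w.v :=
  φ.holds_congr w.M fun _ hy => Function.update_of_ne (fun (e : _ = x) => h (e ▸ hy)) _ _

theorem prob_sh_upd {x : ℕ} {φ : Fml L} (h : x ∉ φ.fvl) (w : World T) (a : ℕ) :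
    (φ.prob T).sh (w.upd x a) = (φ.prob T).sh w := by
  induction φ generalizing w with
  | eq t s => funext _ _; exact propext (holds_upd_of_notMem h w a)
  | rel R ts => funext _ _; exact propext (holds_upd_of_notMem h w a)
  | neg φ ih => funext f u; exact congrArg Not (congrFun (congrFun (ih h w) _) _)
  | or φ ψ ihφ ihψ =>
    simp only [fvl, List.mem_append, not_or] at h
    funext u y
    exact congrArg₂ Or (congrFun (congrFun (ihφ h.1 w) _) _) (congrFun (congrFun (ihψ h.2 w) _) _)
  | all z φ ih =>
    funext u y
    change (φ.prob T).sh ((w.upd x a).upd z u.1) u.2 y = (φ.prob T).sh (w.upd z u.1) u.2 y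
    by_cases hz : x = z
    · subst hz; rw [World.upd_upd]
    · rw [World.upd_comm _ hz, ih fun hx => h (by simp [fvl, hx, hz])]

theorem prob_upd {x : ℕ} {φ : Fml L} (h : x ∉ φ.fvl) (s : World T → ℕ) :
    (φ.prob T).upd x s = φ.prob T := by
  change Prob.mk _ _ (fun w => (φ.prob T).sh (w.upd x (s w))) = _
  simp only [prob_sh_upd h]

/-- An equality of problems, types included, since substitution affects atomic formulas only. At a
quantifier `∀ y`, either `x` is not free and nothing changes, or `y` does not occur in `t`, so that
the value of `t` survives the update at `y` and the two updates commute. -/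
theorem prob_subst {x : ℕ} {t : FTerm L} {φ : Fml L} (h : φ.FreeFor x t) :
    (φ.subst x t).prob T = (φ.prob T).upd x (fun w => letI := w.M; t.realize w.v) := by
  induction φ with
  | eq s r =>
    simp only [subst, prob, Prob.upd, Holds, realize_tsubst]
    rfl
  | rel R ts =>
    simp only [subst, prob, Prob.upd, Holds, realize_tsubst]
    rfl
  | neg φ ih => rw [subst, prob, ih h]; rfl
  | or φ ψ ihφ ihψ => rw [subst, prob, ihφ h.1, ihψ h.2]; rfl
  | all y φ ih =>
    by_cases hx : x ∈ (all y φ).fvl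
    · have hyx : y ≠ x := by
        rintro rfl
        simp [fvl] at hx
      obtain ⟨hy, h⟩ := h.resolve_left (not_not_intro hx)
      rw [subst, if_neg hyx, prob, ih h]
      change Prob.mk _ _ _ = Prob.mk _ _ _
      congr
      funext w u
      have : ∀ a, (letI := w.M; t.realize (w.upd y a).v) = (letI := w.M; t.realize w.v) :=
        fun a => letI := w.M; realize_update_of_notMem w.M t a hy
      exact congrArg (fun w => (φ.prob T).sh w u.2)
        ((congrArg _ (this u.1)).trans (World.upd_comm w hyx _ _))
    · rw [subst_of_notMem hx, prob_upd hx]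

/-- Formulas without quantifiers. -/
def IsOpen : Fml L → Prop
  | eq _ _ => True
  | rel _ _ => True
  | neg φ => φ.IsOpen
  | or φ ψ => φ.IsOpen ∧ ψ.IsOpen
  | all _ _ => False

theorem IsOpen.sh_iff {φ : Fml L} (h : φ.IsOpen) (w : World T) (u : (φ.prob T).U)
    (x : (φ.prob T).X) : (φ.prob T).sh w u x ↔ φ.Holds w.M w.v := by
  induction φ with
  | eq | rel => rfl
  | neg φ ih => exact not_congr (ih h _ _)
  | or φ ψ ihφ ihψ => exact or_congr (ihφ h.1 _ _) (ihψ h.2 _ _)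
  | all => exact h.elim

/-- Without quantifiers the relation ignores challenge and reply, so any reply will do. -/
theorem IsOpen.realized {φ : Fml L} (h : φ.IsOpen) (hφ : ∀ w : World T, φ.Holds w.M w.v) :
    (φ.prob T).Realized :=
  ⟨fun _ _ => TupRep.zero _, Def.zero, fun w _ => (h.sh_iff w _ _).2 (hφ w)⟩

theorem realized_closeN {n : ℕ} {φ : Fml L} (h : (φ.prob T).Realized) :
    ((closeN n φ).prob T).Realized := by
  induction n generalizing φ with
  | zero => exact h
  | succ n ih => exact ih (h.all n)

theorem isOpen_eqImp {φ : Fml L} (h : φ.IsOpen) :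
    ∀ {n : ℕ} (x y : Fin n → ℕ), (eqImp x y φ).IsOpen
  | 0, _, _ => h
  | _ + 1, _, _ => ⟨trivial, isOpen_eqImp h _ _⟩

theorem holds_eqImp (M : (sig L).Structure ℕ) (v : ℕ → ℕ) {φ : Fml L} :
    ∀ {n : ℕ} (x y : Fin n → ℕ), ((∀ i, v (x i) = v (y i)) → φ.Holds M v) →
      (eqImp x y φ).Holds M v
  | 0, _, _, h => h fun i => i.elim0
  | _ + 1, x, y, h => by
    by_cases h₀ : v (x 0) = v (y 0)
    · exact Or.inr (holds_eqImp M v _ _ fun h' => h (Fin.cases h₀ h'))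
    · exact Or.inl h₀

theorem realized_of_eqAx {φ : Fml L} (h : EqAx φ) : (φ.prob T).Realized := by
  cases h with
  | refl x => exact IsOpen.realized trivial fun _ => rfl
  | func f x y =>
    refine IsOpen.realized (isOpen_eqImp (φ := eq _ _) trivial _ _) fun w => holds_eqImp _ _ _ _ fun h => ?_
    exact congrArg (w.M.funMap f) (funext h)
  | rel R x y =>
    refine IsOpen.realized (isOpen_eqImp (φ := or (neg (rel _ _)) (rel _ _))
      ⟨trivial, trivial⟩ _ _) fun w =>
      holds_eqImp _ _ _ _ fun h => not_or_of_imp fun h' => ?_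
    change w.M.RelMap R fun i => w.v (y i)
    rw [← show (fun i => w.v (x i)) = fun i => w.v (y i) from funext h]
    exact h'
  | eq x y =>
    refine IsOpen.realized (isOpen_eqImp (φ := or (neg (eq _ _)) (eq _ _))
      ⟨trivial, trivial⟩ _ _) fun w =>
      holds_eqImp _ _ _ _ fun h => not_or_of_imp fun h' => ?_
    exact ((h 0).symm.trans h').trans (h 1)

end Fml

/-! ### Soundness of the axioms of arithmetic and of the rules -/

theorem World.realize_prT (w : World T) {n : ℕ} (f : PR n) (ts : Fin n → FTerm L) :
    letI := w.M
    (prT f ts).realize w.v = f.eval fun i => (ts i).realize w.v :=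
  w.std.funMap f _

theorem World.realize_zeroT (w : World T) : letI := w.M; (zeroT : FTerm L).realize w.v = 0 :=
  w.realize_prT _ _

theorem World.realize_succT (w : World T) (t : FTerm L) :
    letI := w.M; (succT t).realize w.v = t.realize w.v + 1 :=
  w.realize_prT _ _

theorem World.holds_lt (w : World T) (t s : FTerm L) : letI := w.M
    (Fml.lt t s).Holds w.M w.v ↔ t.realize w.v < s.realize w.v :=
  w.std.relMap_lt _

namespace Fml

/-- The only variable of `S x` is `x` itself, and in the scope of `∀ x` there is no free `x` to be
replaced. -/
theorem freeFor_succT (x : ℕ) (φ : Fml L) : φ.FreeFor x (succT (.var x)) := by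
  induction φ with
  | eq | rel => trivial
  | neg φ ih => exact ih
  | or φ ψ ihφ ihψ => exact ⟨ihφ, ihψ⟩
  | all y φ ih =>
    by_cases h : x = y
    · subst h
      exact Or.inl (by simp [FV, fvl])
    · exact Or.inr ⟨by simpa [succT, prT, tvars] using Ne.symm h, ih⟩

theorem freeFor_zeroT (x : ℕ) (φ : Fml L) : φ.FreeFor x zeroT := by
  induction φ with
  | eq | rel => trivial
  | neg φ ih => exact ih
  | or φ ψ ihφ ihψ => exact ⟨ihφ, ihψ⟩
  | all y φ ih => exact Or.inr ⟨by simp [zeroT, prT, tvars], ih⟩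

theorem realized_of_pa {φ : Fml L} (h : PA φ) : (φ.prob T).Realized := by
  cases h with
  | succ_ne_zero =>
    refine Prob.Realized.all (IsOpen.realized (φ := neg (eq _ _)) trivial fun w => ?_) 0
    simp [Holds, World.realize_zeroT, World.realize_succT]
  | succ_inj =>
    refine Prob.Realized.all (Prob.Realized.all (IsOpen.realized (φ := imp (eq _ _) (eq _ _))
      ⟨trivial, trivial⟩ fun w => ?_) 1) 0
    simp only [imp, Holds, World.realize_succT]
    omega
  | not_lt_zero =>
    refine Prob.Realized.all (IsOpen.realized (φ := neg (lt _ _)) trivial fun w => ?_) 0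
    simp [Holds, World.holds_lt, World.realize_zeroT]
  | lt_succ =>
    refine Prob.Realized.all (Prob.Realized.all (IsOpen.realized (φ := iff _ _)
      (by simp [iff, imp, and, le, lt, IsOpen]) fun w => ?_) 1) 0
    simp only [iff, imp, and, le, Holds, World.holds_lt, World.realize_succT]
    omega
  | proj i => exact realized_closeN (IsOpen.realized trivial fun w => w.realize_prT _ _)
  | comp g h =>
    refine realized_closeN (IsOpen.realized trivial fun w => ?_)
    simp only [Holds, World.realize_prT, PR.eval]
  | prec_zero g h =>
    refine realized_closeN (IsOpen.realized trivial fun w => ?_)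
    simp only [Holds, World.realize_prT, PR.eval, Fin.cons_zero, World.realize_zeroT]
    rfl
  | prec_succ g h =>
    refine realized_closeN (IsOpen.realized trivial fun w => ?_)
    simp only [Holds, World.realize_prT, PR.eval, Fin.cons_zero, World.realize_succT]
    congr 1
    funext i
    cases i using Fin.cases with
    | zero => rfl
    | succ i =>
      cases i using Fin.cases with
      | zero => simp only [Fin.cons_succ, Fin.cons_zero, World.realize_prT, PR.eval]; rfl
      | succ i => rfl
  | ind x φ =>
    have h := Prob.realized_ind (φ.prob_isDec (T := T)) x
    have h₀ := prob_subst (T := T) (freeFor_zeroT x φ)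
    have h₁ := prob_subst (T := T) (freeFor_succT x φ)
    simp only [World.realize_zeroT, World.realize_succT] at h₀ h₁
    -- Substitution of `0` and `S x` has become modification of the valuation, the form in which
    -- induction was solved.
    simp only [imp, and, prob, h₀, h₁]
    exact h

/-- Soundness for the interpretation without the special treatment of bounded quantifiers. -/
theorem realized_of_prov {A : Set (Fml L)} (hA : ∀ φ ∈ A, (φ.prob T).Realized) {φ : Fml L}
    (h : Prov A φ) : (φ.prob T).Realized := by
  induction h with
  | ax h => exact hA _ h
  | em φ => exact Prob.realized_em _
  | inst x t φ h =>
    simp only [imp, prob, prob_subst h]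
    exact Prob.realized_inst _ x (.realize t)
  | eqAx h => exact realized_of_eqAx h
  | expand ψ _ ih => exact ih.expand _
  | contr _ ih => exact Prob.Realized.contr (prob_isDec _) ih
  | assoc _ ih => exact Prob.Realized.assoc ih
  | cut _ _ ih ih' => exact Prob.Realized.cut ih ih'
  | gen x hx _ ih =>
    exact Prob.Realized.gen ih fun w a u y =>
      iff_of_eq (congrFun (congrFun (prob_sh_upd hx w a) u) y)

end Fml

/-! ### The value of the interpretation -/

namespace Fml

theorem tp_all_pos {z : ℕ} {ψ : Fml L} (h : IsBdd z ψ ∧ ψ.tp.2 = []) :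
    (all z ψ).tp = ψ.tp := if_pos h

theorem tp_all_neg {z : ℕ} {ψ : Fml L} (h : ¬ (IsBdd z ψ ∧ ψ.tp.2 = [])) :
    (all z ψ).tp = (.o :: ψ.tp.1, ψ.tp.2) := if_neg h

open Classical in
/-- The relation between tuples of functionals that is expressed by `φ_Sh`. -/
noncomputable def shVal (M : (sig L).Structure ℕ) :
    (φ : Fml L) → (ℕ → ℕ) → DTup φ.tp.1 → DTup φ.tp.2 → Prop
  | .eq t s, v, _, _ => t.realize v = s.realize v
  | .rel R ts, v, _, _ => M.RelMap R (fun i => (ts i).realize v)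
  | .neg ψ, v, us, xs => ¬ ψ.shVal M v xs (DTup.ap us xs)
  | .or ψ χ, v, us, xs =>
      ψ.shVal M v (DTup.left ψ.tp.1 us) (DTup.left ψ.tp.2 xs) ∨
        χ.shVal M v (DTup.right ψ.tp.1 us) (DTup.right ψ.tp.2 xs)
  | .all z ψ, v, us, xs =>
      if h : IsBdd z ψ ∧ ψ.tp.2 = [] then
        ∀ a, ψ.shVal M (Function.update v z a)
          (cast (congrArg (fun p => DTup p.1) (tp_all_pos h)) us)
          (cast (congrArg (fun p => DTup p.2) (tp_all_pos h)) xs)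
      else
        let us' : DTup (.o :: ψ.tp.1) := cast (congrArg (fun p => DTup p.1) (tp_all_neg h)) us
        ψ.shVal M (Function.update v z us'.1) us'.2
          (cast (congrArg (fun p => DTup p.2) (tp_all_neg h)) xs)

end Fml

/-- Formulated for an arbitrary equation `p = q` of type-tuples so that it can be eliminated; it is
applied to the equations computing the types of a quantified formula. -/
theorem Tup.val_cast_fst (M : (sig L).Structure ℕ) (e : Valuation) {Γ : List Ty} (g : CtxVal Γ)
    {p q : List Ty × List Ty} (h : p = q) (t : Tup L Γ p.1) :
    Tup.val M e (cast (congrArg (fun p => Tup L Γ p.1) h) t) g =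
      cast (congrArg (fun p => DTup p.1) h) (t.val M e g) := by
  subst h; rfl

theorem Tup.val_cast_snd (M : (sig L).Structure ℕ) (e : Valuation) {Γ : List Ty} (g : CtxVal Γ)
    {p q : List Ty × List Ty} (h : p = q) (t : Tup L Γ p.2) :
    Tup.val M e (cast (congrArg (fun p => Tup L Γ p.2) h) t) g =
      cast (congrArg (fun p => DTup p.2) h) (t.val M e g) := by
  subst h; rfl

namespace Fml

theorem holds_sh {M : (sig L).Structure ℕ} (hM : Standard M) (e : Valuation) (φ : Fml L) :
    ∀ {Γ : List Ty} (g : CtxVal Γ) (v : ℕ → Tm L Γ .o) (us : Tup L Γ φ.tp.1)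
      (xs : Tup L Γ φ.tp.2), (φ.sh v us xs).Holds M e g ↔
        φ.shVal M (fun y => (v y).val M e g) (us.val M e g) (xs.val M e g) := by
  induction φ with
  | eq t s =>
    intro Γ g v us xs
    simp only [sh, shVal, OFml.Holds, val_iota hM]
  | rel R ts =>
    intro Γ g v us xs
    simp only [sh, shVal, OFml.Holds, val_iota hM]
  | neg ψ ih =>
    -- Stated with the type-tuples of the negation unfolded, as rewriting with the value lemmas
    -- requires.
    have key : ∀ {Γ : List Ty} (g : CtxVal Γ) (v : ℕ → Tm L Γ .o)
        (us : Tup L Γ (Ty.arrowT ψ.tp.1 ψ.tp.2)) (xs : Tup L Γ ψ.tp.1),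
        (ψ.sh v xs (Tup.ap us xs)).Holds M e g ↔ ψ.shVal M (fun y => (v y).val M e g)
          (xs.val M e g) (DTup.ap (us.val M e g) (xs.val M e g)) := by
      intro Γ g v us xs
      rw [ih, Tup.val_ap]
    exact fun _ g v us xs => not_congr (key g v us xs)
  | or ψ χ ihψ ihχ =>
    have key : ∀ {Γ : List Ty} (g : CtxVal Γ) (v : ℕ → Tm L Γ .o)
        (us : Tup L Γ (ψ.tp.1 ++ χ.tp.1)) (xs : Tup L Γ (ψ.tp.2 ++ χ.tp.2)),
        ((ψ.sh v (Tup.left _ us) (Tup.left _ xs)).Holds M e g ∨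
          (χ.sh v (Tup.right _ us) (Tup.right _ xs)).Holds M e g) ↔
        (ψ.shVal M (fun y => (v y).val M e g) (DTup.left _ (us.val M e g))
            (DTup.left _ (xs.val M e g)) ∨
          χ.shVal M (fun y => (v y).val M e g) (DTup.right _ (us.val M e g))
            (DTup.right _ (xs.val M e g))) := by
      intro Γ g v us xs
      rw [ihψ, ihχ, Tup.val_left, Tup.val_left, Tup.val_right, Tup.val_right]
    exact fun _ g v us xs => key g v us xs
  | all z ψ ih =>
    intro Γ g v us xs
    by_cases h : IsBdd z ψ ∧ ψ.tp.2 = []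
    · simp only [sh, shVal, dif_pos h, OFml.Holds]
      refine forall_congr' fun a => ?_
      rw [ih, Tup.val_up (σ := .o), Tup.val_up (σ := .o), Tup.val_cast_fst _ _ _ (tp_all_pos h),
        Tup.val_cast_snd _ _ _ (tp_all_pos h)]
      refine iff_of_eq (congrArg (fun v => ψ.shVal M v _ _) (funext fun y => ?_))
      by_cases hy : y = z
      · subst hy
        rw [if_pos rfl, Function.update_self]; rfl
      · rw [if_neg hy, Function.update_of_ne hy]
        exact (v y).val_up M e (σ := .o) a g
    · simp only [sh, shVal, dif_neg h]
      rw [ih, Tup.val_cast_snd _ _ _ (tp_all_neg h)]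
      have h₁ := Tup.val_cast_fst M e g (tp_all_neg h) us
      rw [← h₁]
      refine iff_of_eq (congrArg (fun v => ψ.shVal M v _ _) (funext fun y => ?_))
      by_cases hy : y = z
      · subst hy
        rw [if_pos rfl, Function.update_self]; rfl
      · rw [if_neg hy, Function.update_of_ne hy]

theorem holds_shAll {M : (sig L).Structure ℕ} (hM : Standard M) (e : Valuation) (φ : Fml L)
    (t : Tup L [] (Ty.arrowT φ.tp.1 φ.tp.2)) : (φ.shAll t).Holds M e CtxVal.nil ↔
      ∀ u, φ.shVal M (e .o) u (DTup.ap (t.val M e CtxVal.nil) u) := by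
  rw [shAll, OFml.holds_alls]
  refine forall_congr' fun u => ?_
  rw [holds_sh hM, Tup.val_ap, Tup.val_ren, CtxVal.ext_weak, Tup.val_vars]
  rfl

theorem shVal_congr (M : (sig L).Structure ℕ) (φ : Fml L) : ∀ {v w : ℕ → ℕ},
    (∀ x ∈ φ.fvl, v x = w x) → ∀ u x, φ.shVal M v u x ↔ φ.shVal M w u x := by
  induction φ with
  | eq t s => intro v w h _ _; exact (eq t s).holds_congr M h
  | rel R ts => intro v w h _ _; exact (rel R ts).holds_congr M h
  | neg φ ih => intro v w h u x; exact not_congr (ih h _ _)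
  | or φ ψ ihφ ihψ =>
    intro v w h u x
    exact or_congr (ihφ (fun x hx => h x (List.mem_append_left _ hx)) _ _)
      (ihψ (fun x hx => h x (List.mem_append_right _ hx)) _ _)
  | all y φ ih =>
    intro v w h u x
    have key : ∀ a, ∀ x ∈ φ.fvl, Function.update v y a x = Function.update w y a x := by
      intro a x hx
      by_cases hxy : x = y
      · subst hxy; simp
      · rw [Function.update_of_ne hxy, Function.update_of_ne hxy]
        exact h x (by simp [fvl, hx, hxy])
    simp only [shVal]
    split
    · exact forall_congr' fun a => ih (key a) _ _
    · exact ih (key _) _ _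

/-! ### Comparison of the interpretations -/

/-- A problem whose types are given by a pair of type-tuples. -/
@[reducible] def _root_.ShInt.Prob.ofTp (p : List Ty × List Ty)
    (S : World T → DTup p.1 → DTup p.2 → Prop) : Prob T :=
  { U := DTup p.1, X := DTup p.2, repU := TupRep.tup _, repX := TupRep.tup _, sh := S }

theorem _root_.ShInt.Prob.ofTp_cast {p q : List Ty × List Ty} (h : p = q)
    (S : World T → DTup q.1 → DTup q.2 → Prop) :
    Prob.ofTp p (fun w u x => S w (cast (congrArg (fun p => DTup p.1) h) u)
      (cast (congrArg (fun p => DTup p.2) h) x)) = Prob.ofTp q S := by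
  subst h; rfl

/-- The Shoenfield interpretation. -/
noncomputable def shProb (T : Set (Fml L)) (φ : Fml L) : Prob T :=
  Prob.ofTp φ.tp fun w => φ.shVal w.M w.v

theorem shProb_all_pos {z : ℕ} {ψ : Fml L} (h : IsBdd z ψ ∧ ψ.tp.2 = []) :
    (all z ψ).shProb T = (ψ.shProb T).ball z := by
  refine Eq.trans ?_ (Prob.ofTp_cast (tp_all_pos h)
    fun w u x => ∀ a, ψ.shVal w.M (Function.update w.v z a) u x)
  simp only [shProb, shVal, dif_pos h]

theorem shProb_all_neg {z : ℕ} {ψ : Fml L} (h : ¬ (IsBdd z ψ ∧ ψ.tp.2 = [])) :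
    (all z ψ).shProb T = ((ψ.shProb T).all z).coded := by
  refine Eq.trans ?_ (Prob.ofTp_cast (tp_all_neg h)
    fun w u x => ψ.shVal w.M (Function.update w.v z u.1) u.2 x)
  simp only [shProb, shVal, dif_neg h]

/-- Beyond `t` the guard `¬ z ≤ t` is true, whatever the challenge and reply. The bound on `z` is
inclusive, hence the `+ 1`; that `z` does not occur in `t` keeps the bound fixed while `z` varies.
-/
theorem shVal_of_bound {z : ℕ} {t : FTerm L} {χ : Fml L} (hz : z ∉ tvars t) (w : World T) (a : ℕ)
    (ha : (letI := w.M; t.realize w.v) + 1 ≤ a) (u x) :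
    (or (neg (le (.var z) t)) χ).shVal w.M (w.upd z a).v u x := by
  refine Or.inl fun h => ?_
  have ht : (letI := w.M; t.realize (w.upd z a).v) = (letI := w.M; t.realize w.v) :=
    realize_update_of_notMem w.M t a hz
  have hv : (w.upd z a).v z = a := Function.update_self _ _ _
  rcases h with h | h
  · have h : (w.upd z a).v z < (letI := w.M; t.realize (w.upd z a).v) :=
      ((w.upd z a).holds_lt (.var z) t).1 h
    rw [ht, hv] at h
    omega
  · have h : (w.upd z a).v z = (letI := w.M; t.realize (w.upd z a).v) := h
    rw [ht, hv] at h
    omega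

/-- The two interpretations differ only at bounded quantifiers whose matrix asks for no reply, where
`Prob.equi_ball` applies. Decidability is part of the induction because the search needs it for the
matrix. -/
theorem equi_shProb (φ : Fml L) :
    Prob.Equi (φ.shProb T) (φ.prob T) ∧ (φ.shProb T).IsDec := by
  induction φ with
  | eq t s =>
    exact ⟨Prob.equi_coded ((eq t s).prob T), ((eq t s).prob_isDec (T := T)).coded⟩
  | rel R ts =>
    exact ⟨Prob.equi_coded ((rel R ts).prob T), ((rel R ts).prob_isDec (T := T)).coded⟩
  | neg ψ ih =>
    exact ⟨(Prob.equi_coded (ψ.shProb T).neg).trans ih.1.neg, ih.2.neg.coded⟩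
  | or ψ χ ihψ ihχ =>
    exact ⟨(Prob.equi_coded ((ψ.shProb T).or (χ.shProb T))).trans (ihψ.1.or ihχ.1),
      (ihψ.2.or ihχ.2).coded⟩
  | all z ψ ih =>
    by_cases h : IsBdd z ψ ∧ ψ.tp.2 = []
    · obtain ⟨⟨t, χ, hz, hψ⟩, hX⟩ := id h
      have hb : ∀ (w : World T) a u x, (letI := w.M; t.realize w.v) + 1 ≤ a →
          (ψ.shProb T).sh (w.upd z a) u x := by
        subst hψ
        exact fun w a u x ha => shVal_of_bound hz w a ha u x
      have hs : ∀ {A : Type} [TupRep A],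
          Def (fun (w : World T) (_ : A) => (letI := w.M; t.realize w.v) + 1) :=
        fun {A} _ => (Def.realize t).natFun (· + 1)
      have hX' : Subsingleton (ψ.shProb T).X := by
        change Subsingleton (DTup ψ.tp.2)
        rw [hX]
        exact inferInstanceAs (Subsingleton Unit)
      rw [shProb_all_pos h]
      exact ⟨(Prob.equi_ball ih.2 hX' z hs hb).trans (ih.1.all z), ih.2.ball z hs hb⟩
    · rw [shProb_all_neg h]
      exact ⟨(Prob.equi_coded _).trans (ih.1.all z), (ih.2.all z).coded⟩

/-! ### Universal sentences -/

theorem QF.tp_eq {φ : Fml L} (h : φ.QF) : φ.tp = ([], []) := by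
  induction φ with
  | eq | rel => rfl
  | neg φ ih => simp only [tp, ih h, Ty.arrowT, List.map_nil]
  | or φ ψ ihφ ihψ => simp only [tp, ihφ h.1, ihψ h.2, List.append_nil]
  | all z φ ih => rw [tp_all_pos ⟨h.1, by rw [ih h.2]⟩, ih h.2]

theorem QF.shVal_iff {φ : Fml L} (h : φ.QF) (M : (sig L).Structure ℕ) (v : ℕ → ℕ) (u x) :
    φ.shVal M v u x ↔ φ.Holds M v := by
  induction φ generalizing v with
  | eq | rel => rfl
  | neg φ ih => exact not_congr (ih h _ _ _)
  | or φ ψ ihφ ihψ => exact or_congr (ihφ h.1 _ _ _) (ihψ h.2 _ _ _)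
  | all z φ ih =>
    rw [shVal, dif_pos ⟨h.1, by rw [h.2.tp_eq]⟩]
    exact forall_congr' fun a => ih h.2 _ _ _

/-- A quantifier-free matrix expresses its own truth, and each challenge to the prefix selects an
instance of a true formula. -/
theorem IsUniversal.shVal {φ : Fml L} (h : φ.IsUniversal) {M : (sig L).Structure ℕ} {v : ℕ → ℕ}
    (hφ : φ.Holds M v) (u x) : φ.shVal M v u x := by
  induction h generalizing v with
  | qf h => exact (h.shVal_iff M v u x).2 hφ
  | all z _ ih =>
    rw [Fml.shVal]
    split
    · exact fun a => ih (hφ a) _ _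
    · exact ih (hφ _) _ _

/-- The detour through `shProb` is needed because in `prob` a negated bounded quantifier does ask
for a reply; the reduction supplies it by search. -/
theorem IsUniversal.realized {φ : Fml L} (h : φ.IsUniversal) (hφ : φ ∈ T) :
    (φ.prob T).Realized :=
  Prob.Realized.sim (P := φ.shProb T) ⟨fun _ _ => TupRep.zero _, Def.zero,
    fun w _ => h.shVal (w.sat φ hφ _) _ _⟩ (equi_shProb φ).1.1

end Fml

/-! ### Elimination of superfluous free variables -/

/-- Simultaneous substitution for the free variables of a tuple. -/
def Tup.fsub {Γ : List Ty} (σ : ∀ ρ, ℕ → Tm L Γ ρ) : {l : List Ty} → Tup L Γ l → Tup L Γ l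
  | [], _ => PUnit.unit
  | _ :: _, t => (t.1.fsub (fun _ x => x) σ, Tup.fsub σ t.2)

theorem Tup.val_fsub (M : (sig L).Structure ℕ) (e : Valuation) {Γ : List Ty}
    (σ : ∀ ρ, ℕ → Tm L Γ ρ) (g : CtxVal Γ) : ∀ {l : List Ty} (t : Tup L Γ l),
      (t.fsub σ).val M e g = t.val M (fun ρ x => (σ ρ x).val M e g) g
  | [], _ => rfl
  | _ :: _, t => Prod.ext (t.1.val_fsub M e _ σ g) (Tup.val_fsub M e σ g t.2)

theorem Tup.FV_fsub_subset {Γ : List Ty} {σ : ∀ ρ, ℕ → Tm L Γ ρ} {S : Set (Ty × ℕ)}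
    (h : ∀ ρ x, (σ ρ x).FV ⊆ S) : ∀ {l : List Ty} (t : Tup L Γ l), (t.fsub σ).FV ⊆ S
  | [], _ => Set.empty_subset _
  | _ :: _, t => Set.union_subset (t.1.FV_fsub_subset _ σ h) (Tup.FV_fsub_subset h t.2)

/-- Variables outside `S` are replaced by closed zero terms. This has the same effect as evaluating
the old terms under a valuation that vanishes there and agrees with `e` on `S`. -/
theorem Tup.exists_FV_subset {l : List Ty} (t : Tup L [] l) (S : Set ℕ) :
    ∃ t' : Tup L [] l, t'.FV ⊆ (fun x => (Ty.o, x)) '' S ∧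
      ∀ (M : (sig L).Structure ℕ) (e : Valuation), ∃ e' : Valuation,
        (∀ x ∈ S, e' .o x = e .o x) ∧ t'.val M e CtxVal.nil = t.val M e' CtxVal.nil := by
  classical
  let σ : ∀ ρ, ℕ → Tm L [] ρ := fun ρ x => if ρ = .o ∧ x ∈ S then .fvar ρ x else .zeroAt ρ
  refine ⟨t.fsub σ, Tup.FV_fsub_subset (fun ρ x => ?_) t, fun M e =>
    ⟨_, fun x hx => ?_, t.val_fsub M e σ _⟩⟩
  · by_cases h : ρ = .o ∧ x ∈ S
    · simp only [σ, if_pos h, Tm.FV, h.1]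
      exact Set.singleton_subset_iff.2 ⟨x, h.2, rfl⟩
    · simp only [σ, if_neg h, Tm.FV_zeroAt]
      exact Set.empty_subset _
  · simp only [σ, if_pos (And.intro (rfl : Ty.o = Ty.o) hx)]
    rfl

theorem Fml.exists_tup_of_realized {φ : Fml L} (h : (φ.shProb T).Realized) :
    ∃ t : Tup L [] (Ty.arrowT φ.tp.1 φ.tp.2), ∀ (w : World T) u,
      φ.shVal w.M w.v u (DTup.ap (t.val w.M w.e CtxVal.nil) u) := by
  obtain ⟨F, hF, h⟩ : ∃ F : World T → DTup φ.tp.1 → DTup φ.tp.2,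
      TupDef (fun w (g : CtxVal φ.tp.1) => F w g.tup) ∧
        ∀ (w : World T) u, φ.shVal w.M w.v u (F w u) := h
  -- Abstraction expects the context in the form `l ++ Γ`, so `φ.tp.1` is first embedded in `φ.tp.1
  -- ++ []`.
  obtain ⟨t, ht⟩ := (hF.ren (embVar (Γ := []))).abs
  refine ⟨t, fun w u => ?_⟩
  rw [ht]
  simp only [CtxVal.tup_ext, DTup.ap_abs]
  exact h w u

end ShInt

/-! ### The soundness theorem -/

theorem theorem1 {L : FirstOrder.Language.{u, v}} (Γ : Set (ShInt.Fml L))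
    (hΓ : ∀ γ ∈ Γ, γ.IsUniversal ∧ γ.IsSentence)
    (φ : ShInt.Fml L) (hφ : ShInt.Prov ({ψ | ShInt.PA ψ} ∪ Γ) φ) :
    ∃ t : ShInt.Tup L [] (ShInt.Ty.arrowT φ.tp.1 φ.tp.2),
      t.FV ⊆ (fun x => (ShInt.Ty.o, x)) '' φ.FV ∧
      ∀ M : (ShInt.sig L).Structure ℕ,
        (@FirstOrder.Language.LHom.reduct ShInt.arith (ShInt.sig L) FirstOrder.Language.LHom.sumInl ℕ M
          = ShInt.stdN) →
        (∀ γ ∈ Γ, ∀ e : ℕ → ℕ, γ.Holds M e) →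
        ∀ e : ShInt.Valuation, (φ.shAll t).Holds M e ShInt.CtxVal.nil := by
  have h : (φ.prob Γ).Realized := by
    refine ShInt.Fml.realized_of_prov (fun ψ hψ => ?_) hφ
    rcases hψ with hψ | hψ
    · exact ShInt.Fml.realized_of_pa hψ
    · exact (hΓ ψ hψ).1.realized hψ
  obtain ⟨t, ht⟩ := ShInt.Fml.exists_tup_of_realized (h.sim φ.equi_shProb.1.2)
  obtain ⟨t', hFV, ht'⟩ := t.exists_FV_subset φ.FV
  refine ⟨t', hFV, fun M hM hsat e => (ShInt.Fml.holds_shAll hM e φ t').2 fun u => ?_⟩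
  -- The original terms are correct under every valuation, in particular under `e'`; as `e'` agrees
  -- with `e` on the free variables of `φ`, correctness passes to `e`.
  obtain ⟨e', he, hval⟩ := ht' M e
  rw [hval]
  exact (ShInt.Fml.shVal_congr M φ he _ _).1 (ht ⟨M, hM, hsat, e'⟩ u)
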